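/- **Setting.** Let $\kappa$ be an uncountable cardinal, $\mathfrak M$ a $\kappa$-saturated structure in a many-sorted first-order language, and $G$ a group definable in $\mathfrak M$. Definable means definable with parameters; a *type-definable* set is an intersection of fewer than $\kappa$ definable sets. A subset $X\subseteq G$ is *symmetric* if $1\in X=X^{-1}$, and $X^n$ is the set of products of $n$ elements of $X$ ($X^0=\{1\}$). Let $A\subseteq G$ be definable and symmetric, and let $(T_i)_{i\in\mathbb N}$ be definable symmetric subsets of $G$ with $T_{i+1}^2\subseteq T_i$ and $x^{-1}T_{i+1}x\subseteq T_i$ for all $x\in A$. Put $T_\infty=\bigcap_i T_i$. For a symmetric definable $T'\subseteq G$, a *$T'$-rough measure* is an increasing subadditive function $\mu$ from the definable subsets of $G$ to $[0,\infty]$ such that $\mu(Y\cup Z)=\mu(Y)+\mu(Z)$ whenever $Y\cap ZT'=\emptyset$. The set $A$ is *$T$-rough definably amenable*, witnessed by $(\mu_i)_{i\in\mathbb N}$, if each $\mu_i$ is a $T_i$-rough measure, invariant under left translations, with $\mu_i(A)=1$. A definable set $Y\subseteq G$ is *$t$-thick* in $X\subseteq G$ if for all $g_0,\dots,g_t\in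 X$ there are $i<j$ with $g_i^{-1}g_j\in Y$. A type-definable set is *thick* in $X$ if each of its definable supersets is $t$-thick in $X$ for some $t\in\mathbb N$. **Proposition.** Let $A$ be $T$-rough definably amenable, witnessed by $(\mu_i)_{i\in\mathbb N}$, and let $m,r\in\mathbb N$ and $K_i\in\mathbb N$ $(i\in\mathbb N)$ be such that $\mu_i(A^{2m+r})\le K_i$ for all $i$. Let $B\subseteq A^m$ be type-definable and thick in $A$. Then there is a type-definable set $S\subseteq B^2T_\infty\cap A^{2m}$, thick in $A^m$, such that $S^r\subseteq B^4T_\infty$. If moreover $B$ is thick in $A^m$ (for instance, if $m=1$), then $S$ can be chosen inside $B^2$. -/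

import Mathlib

open scoped Pointwise ENNReal Cardinal

universe u v w a

/-- A many-sorted first-order language. -/
structure MSLanguage where
  /-- the sorts -/
  Sorts : Type u
  /-- the function symbols (constants have arity zero) -/
  Functions : Type v
  /-- the relation symbols -/
  Relations : Type v
  /-- the number of arguments of a function symbol -/
  farity : Functions → ℕ
  /-- the sorts of the arguments of a function symbol -/
  fdom : (f : Functions) → Fin (farity f) → Sorts
  /-- the sort of the value of a function symbol -/
  fcod : Functions → Sorts
  /-- the number of arguments of a relation symbol -/
  rarity : Relations → ℕ
  /-- the sorts of the arguments of a relation symbol -/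
  rdom : (R : Relations) → Fin (rarity R) → Sorts

namespace MSLanguage

/-- Interpretations of the symbols of `L` on a family `M` of universes, one for each sort. -/
class Structure (L : MSLanguage.{u, v}) (M : L.Sorts → Type w) where
  /-- interpretation of function symbols -/
  funMap : (f : L.Functions) → ((i : Fin (L.farity f)) → M (L.fdom f i)) → M (L.fcod f)
  /-- interpretation of relation symbols -/
  RelMap : (R : L.Relations) → ((i : Fin (L.rarity R)) → M (L.rdom R i)) → Prop

/-- Terms of `L` whose variables are indexed by `α`, the variable `x` having sort `σ x`. -/
inductive Term (L : MSLanguage.{u, v}) {α : Type a} (σ : α → L.Sorts) :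
    L.Sorts → Type (max a u v)
  | var (x : α) : Term L σ (σ x)
  | app (f : L.Functions) (ts : (i : Fin (L.farity f)) → Term L σ (L.fdom f i)) :
      Term L σ (L.fcod f)

/-- The context `σ` with one more variable, of sort `s`. -/
def extendSort {S : Type u} {α : Type a} (σ : α → S) (s : S) : Option α → S
  | none => s
  | some x => σ x

/-- First-order formulas of `L` with free variables indexed by `α`, the variable `x` having sort
`σ x`. The quantifier binds the variable `none`. -/
inductive Formula (L : MSLanguage.{u, v}) :
    {α : Type a} → (α → L.Sorts) → Type (max (a + 1) u v)
  | falsum {α : Type a} {σ : α → L.Sorts} : Formula L σ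
  | equal {α : Type a} {σ : α → L.Sorts} {s : L.Sorts} (t₁ t₂ : Term L σ s) : Formula L σ
  | rel {α : Type a} {σ : α → L.Sorts} (R : L.Relations)
      (ts : (i : Fin (L.rarity R)) → Term L σ (L.rdom R i)) : Formula L σ
  | imp {α : Type a} {σ : α → L.Sorts} (φ ψ : Formula L σ) : Formula L σ
  | all {α : Type a} {σ : α → L.Sorts} (s : L.Sorts) (φ : Formula L (extendSort σ s)) :
      Formula L σ

section Semantics

variable {L : MSLanguage.{u, v}} {M : L.Sorts → Type w}

/-- The value of a term under an assignment. -/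
def Term.realize [L.Structure M] {α : Type a} {σ : α → L.Sorts} (x : (i : α) → M (σ i)) :
    {s : L.Sorts} → Term L σ s → M s
  | _, .var i => x i
  | _, .app f ts => Structure.funMap f (fun i => (ts i).realize x)

/-- Extend an assignment by a value for the new variable. -/
def extendVal {α : Type a} {σ : α → L.Sorts} (x : (i : α) → M (σ i)) {s : L.Sorts} (y : M s) :
    (i : Option α) → M (extendSort σ s i)
  | none => y
  | some i => x i

/-- Satisfaction of a formula under an assignment. -/
def Formula.Realize [L.Structure M] : {α : Type a} → {σ : α → L.Sorts} → Formula L σ →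
    ((i : α) → M (σ i)) → Prop
  | _, _, .falsum, _ => False
  | _, _, .equal t₁ t₂, x => t₁.realize x = t₂.realize x
  | _, _, .rel R ts, x => Structure.RelMap R (fun i => (ts i).realize x)
  | _, _, .imp φ ψ, x => φ.Realize x → ψ.Realize x
  | _, _, .all s φ, x => ∀ y : M s, φ.Realize (extendVal x y)

/-- The sorts of the variables `α` together with one variable for each parameter in `C`. -/
def paramSort {α : Type} (σ : α → L.Sorts) (C : Set (Σ s, M s)) : α ⊕ C → L.Sorts
  | .inl i => σ i
  | .inr c => c.1.1

/-- The assignment that gives the parameters in `C` their own value. -/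
def paramVal {α : Type} {σ : α → L.Sorts} (C : Set (Σ s, M s)) (x : (i : α) → M (σ i)) :
    (i : α ⊕ C) → M (paramSort σ C i)
  | .inl i => x i
  | .inr c => c.1.2

/-- A set of tuples is definable if it is the solution set of a first-order formula with finitely
many parameters. -/
def Definable (L : MSLanguage.{u, v}) {M : L.Sorts → Type w} [L.Structure M] {α : Type}
    {σ : α → L.Sorts} (X : Set ((i : α) → M (σ i))) : Prop :=
  ∃ C : Set (Σ s, M s), C.Finite ∧
    ∃ φ : Formula L (paramSort σ C), X = {x | φ.Realize (paramVal C x)}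

/-- `M` is `κ`-saturated: each set of formulas in finitely many variables, with parameters from a
set of size less than `κ`, that is finitely satisfiable in `M` is satisfiable in `M`. -/
def IsSaturated (L : MSLanguage.{u, v}) (M : L.Sorts → Type w) [L.Structure M]
    (κ : Cardinal.{w}) : Prop :=
  ∀ C : Set (Σ s, M s), #C < Cardinal.lift.{u} κ →
    ∀ (n : ℕ) (σ : Fin n → L.Sorts) (Φ : Set (Formula L (paramSort σ C))),
      (∀ Ψ ⊆ Φ, Ψ.Finite → ∃ x : (i : Fin n) → M (σ i), ∀ φ ∈ Ψ, φ.Realize (paramVal C x)) →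
      ∃ x : (i : Fin n) → M (σ i), ∀ φ ∈ Φ, φ.Realize (paramVal C x)

end Semantics

/-- A group definable in `M`: a definable set of finite tuples, with a group law whose graph is
definable. -/
structure DefinableGroup (L : MSLanguage.{u, v}) (M : L.Sorts → Type w) [L.Structure M] where
  /-- the length of the tuples -/
  n : ℕ
  /-- the sorts of the coordinates -/
  sort : Fin n → L.Sorts
  /-- the underlying definable set -/
  carrier : Set ((i : Fin n) → M (sort i))
  definable_carrier : Definable L carrier
  /-- the group law -/
  group : Group carrier
  definable_mul : Definable L (σ := fun p : Fin 3 × Fin n => sort p.2)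
    {z | ∃ x y : carrier, (∀ i, z (0, i) = x.1 i) ∧ (∀ i, z (1, i) = y.1 i) ∧
      ∀ i, z (2, i) = (x * y).1 i}

namespace DefinableGroup

variable {L : MSLanguage.{u, v}} {M : L.Sorts → Type w} [L.Structure M]

instance : CoeSort (DefinableGroup L M) (Type w) := ⟨fun G => G.carrier⟩

instance (G : DefinableGroup L M) : Group G := G.group

/-- Definable subsets of a definable group. -/
def IsDefinable (G : DefinableGroup L M) (Y : Set G) : Prop :=
  Definable L (Subtype.val '' Y)

/-- Type-definable subsets: intersections of fewer than `κ` definable sets. -/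
def IsTypeDefinable (G : DefinableGroup L M) (κ : Cardinal.{w}) (Y : Set G) : Prop :=
  ∃ F : Set (Set G), #F < κ ∧ (∀ Z ∈ F, G.IsDefinable Z) ∧ Y = ⋂₀ F

/-- A subset is symmetric if it contains `1` and is closed under inversion. -/
def IsSymmetric (G : DefinableGroup L M) (Y : Set G) : Prop :=
  1 ∈ Y ∧ Y⁻¹ = Y

/-- `Y` is `t`-thick in `X`: among any `t + 1` elements of `X`, listed in any order and possibly
with repetitions, an earlier `g i` and a later `g j` satisfy `(g i)⁻¹ * g j ∈ Y`. -/
def IsThickWith (G : DefinableGroup L M) (t : ℕ) (Y X : Set G) : Prop :=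
  ∀ g : Fin (t + 1) → G, (∀ i, g i ∈ X) → ∃ i j, i < j ∧ (g i)⁻¹ * g j ∈ Y

/-- `Y` is thick in `X`: each definable superset of `Y` is `t`-thick in `X` for some `t`. -/
def IsThick (G : DefinableGroup L M) (Y X : Set G) : Prop :=
  ∀ Z : Set G, G.IsDefinable Z → Y ⊆ Z → ∃ t : ℕ, G.IsThickWith t Z X

/-- `μ` is a `T`-rough measure on the definable subsets of `G`. Its values on other sets play no
role. -/
structure IsRoughMeasure (G : DefinableGroup L M) (T : Set G) (μ : Set G → ℝ≥0∞) : Prop where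
  mono : ∀ Y Z, G.IsDefinable Y → G.IsDefinable Z → Y ⊆ Z → μ Y ≤ μ Z
  subadditive : ∀ Y Z, G.IsDefinable Y → G.IsDefinable Z → μ (Y ∪ Z) ≤ μ Y + μ Z
  additive : ∀ Y Z, G.IsDefinable Y → G.IsDefinable Z → Y ∩ (Z * T) = ∅ →
    μ (Y ∪ Z) = μ Y + μ Z

/-- The rough measures `μ i` witness that `A` is `T`-rough definably amenable: `μ i` is
`T i`-rough, invariant under left translations and normalised at `A`. -/
structure IsRoughAmenable (G : DefinableGroup L M) (A : Set G) (T : ℕ → Set G)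
    (μ : ℕ → Set G → ℝ≥0∞) : Prop where
  rough : ∀ i, G.IsRoughMeasure (T i) (μ i)
  invariant : ∀ i (g : G) (Y : Set G), G.IsDefinable Y → μ i (g • Y) = μ i Y
  normalised : ∀ i, μ i A = 1

/-- The requirements on the sequence of error sets `T i`. -/
structure IsErrorSequence (G : DefinableGroup L M) (A : Set G) (T : ℕ → Set G) : Prop where
  definable : ∀ i, G.IsDefinable (T i)
  symmetric : ∀ i, G.IsSymmetric (T i)
  sq_subset : ∀ i, T (i + 1) ^ 2 ⊆ T i
  conj_subset : ∀ i, ∀ x ∈ A, ∀ y ∈ T (i + 1), x⁻¹ * y * x ∈ T i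

end DefinableGroup

end MSLanguage

/-! This is Sanders's stabiliser argument, with errors carried along in the sets `T i`. Saturation
reduces the claim to definable sets. For every finite intersection `D` of the sets defining `B` and
every `i`, one needs a definable `S`, thick in `A ^ m`, with `S ⊆ D ^ 2 * T i` and `S ^ r ⊆ D ^ 4 *
T i` (`exists_definable_thick`). The intersection of all these `S` then works, because finite
intersections of thick sets are thick by Ramsey's theorem (`isThick_sInter`), and products commute
with directed intersections (`iInter_mul_subset`).

For one symmetric `D ⊆ A ^ 2`, choose `C ⊆ D` that almost minimises the measure of `C * D` among its
large subsets. Ignoring errors: if `C ∩ a • C` is still large, then `(C ∩ a • C) * D` lies in both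
`F = C * D` and `a • F` and has almost the measure of `F`, so `a` almost stabilises `F`. Products of
`s` such elements still almost stabilise `F`. For a product `x * y` of `2 * s` of them, `x⁻¹ • F`
and `y • F` therefore meet, so `x * y ∈ F * F⁻¹ ⊆ D ^ 4`. These `a` form a thick set, since many
translates of `C` inside a set of finite measure cannot be almost disjoint.

Two difficulties shape the details. Having measure at least `δ` is not a definable condition, so it
is replaced by `IsLarge`. This follows from positive measure (`IsRoughMeasure.exists_isLarge`), is
definable in families (`DefinablePred.isLarge`), and turns a drop of rank by one into thickness.
Moreover, finiteness of the measure is known only inside a fixed power of `A`. The minimised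
quantity is therefore a sum of measures cut off to windows `Q l`, where `Q l` contains `x⁻¹ • F` for
every product `x` of `l` stabilising elements. -/

namespace MSLanguage

/-! ### Change of variables in many-sorted formulas. -/

section Relabelling

universe b

variable {L : MSLanguage.{u, v}}

/-- Sorts of corresponding variables are equal only propositionally, so assignments are compared by
`HEq` and the new term is asserted to exist rather than built with casts. -/
theorem Term.exists_relabel {α : Type a} {β : Type b} {σ : α → L.Sorts} {τ : β → L.Sorts}
    (ρ : α → β) (h : ∀ i, τ (ρ i) = σ i) {s : L.Sorts} (t : Term L σ s) :
    ∃ t' : Term L τ s, ∀ (M : L.Sorts → Type w) [L.Structure M]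
      (x : (i : α) → M (σ i)) (y : (i : β) → M (τ i)), (∀ i, HEq (x i) (y (ρ i))) →
        t'.realize y = t.realize x := by
  induction t with
  | var i =>
    have key : ∀ s, τ (ρ i) = s → ∃ t' : Term L τ s, ∀ (M : L.Sorts → Type w) [L.Structure M]
        (y : (i : β) → M (τ i)), HEq (t'.realize y) (y (ρ i)) := by
      rintro s rfl
      exact ⟨.var (ρ i), fun M _ y => by simp [Term.realize]⟩
    obtain ⟨t', ht'⟩ := key _ (h i)
    refine ⟨t', fun M _ x y hxy => ?_⟩
    rw [Term.realize]
    exact eq_of_heq ((ht' M y).trans (hxy i).symm)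
  | app f ts ih =>
    choose ts' hts' using ih
    refine ⟨.app f ts', fun M _ x y hxy => ?_⟩
    rw [Term.realize, Term.realize]
    congr 1
    funext i
    exact hts' i M x y hxy

theorem Formula.exists_relabel {α : Type a} {σ : α → L.Sorts} (φ : Formula L σ)
    {β : Type b} {τ : β → L.Sorts} (ρ : α → β) (h : ∀ i, τ (ρ i) = σ i) :
    ∃ φ' : Formula L τ, ∀ (M : L.Sorts → Type w) [L.Structure M]
      (x : (i : α) → M (σ i)) (y : (i : β) → M (τ i)), (∀ i, HEq (x i) (y (ρ i))) →
        (φ'.Realize y ↔ φ.Realize x) := by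
  induction φ generalizing β with
  | falsum => exact ⟨.falsum, fun M _ x y _ => by simp [Formula.Realize]⟩
  | equal t₁ t₂ =>
    obtain ⟨t₁', h₁⟩ := t₁.exists_relabel ρ h
    obtain ⟨t₂', h₂⟩ := t₂.exists_relabel ρ h
    exact ⟨.equal t₁' t₂', fun M _ x y hxy => by
      rw [Formula.Realize, Formula.Realize, h₁ M x y hxy, h₂ M x y hxy]⟩
  | rel R ts =>
    choose ts' hts' using fun i => (ts i).exists_relabel ρ h
    refine ⟨.rel R ts', fun M _ x y hxy => ?_⟩
    rw [Formula.Realize, Formula.Realize]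
    have : (fun i => (ts' i).realize y) = fun i => (ts i).realize x :=
      funext fun i => hts' i M x y hxy
    rw [this]
  | imp φ ψ ihφ ihψ =>
    obtain ⟨φ', hφ⟩ := ihφ ρ h
    obtain ⟨ψ', hψ⟩ := ihψ ρ h
    exact ⟨.imp φ' ψ', fun M _ x y hxy => by
      rw [Formula.Realize, Formula.Realize, hφ M x y hxy, hψ M x y hxy]⟩
  | @all α σ s φ ih =>
    obtain ⟨φ', hφ⟩ := ih (τ := extendSort τ s) (Option.map ρ) (by
      rintro (_ | i)
      · rfl
      · exact h i)
    refine ⟨.all s φ', fun M _ x y hxy => ?_⟩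
    rw [Formula.Realize, Formula.Realize]
    refine forall_congr' fun z => hφ M _ _ ?_
    rintro (_ | i)
    · exact HEq.rfl
    · exact hxy i

end Relabelling

/-! ### Closure properties of definable sets of tuples. -/

section Definable

variable {L : MSLanguage.{u, v}} {M : L.Sorts → Type w} [L.Structure M]

/-- Enlarging the parameter set lets several definable sets be described over a common one, as
Boolean operations and saturation require. -/
theorem Definable.exists_formula {α : Type} {σ : α → L.Sorts} {X : Set ((i : α) → M (σ i))}
    (hX : Definable L X) : ∃ C : Set (Σ s, M s), C.Finite ∧ ∀ C', C ⊆ C' →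
      ∃ φ : Formula L (paramSort σ C'), X = {x | φ.Realize (paramVal C' x)} := by
  obtain ⟨C, hC, φ, rfl⟩ := hX
  refine ⟨C, hC, fun C' hCC' => ?_⟩
  obtain ⟨φ', hφ'⟩ := φ.exists_relabel.{_, _, w} (τ := paramSort σ C')
    (Sum.map id (Set.inclusion hCC')) (by rintro (i | c) <;> rfl)
  refine ⟨φ', Set.ext fun x => (hφ' M _ _ ?_).symm⟩
  rintro (i | c) <;> rfl

theorem Definable.relabel {α β : Type} {σ : α → L.Sorts} {τ : β → L.Sorts}
    {X : Set ((i : α) → M (σ i))} (hX : Definable L X) (ρ : α → β) (h : ∀ i, τ (ρ i) = σ i)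
    {Y : Set ((i : β) → M (τ i))}
    (hXY : ∀ x y, (∀ i, HEq (x i) (y (ρ i))) → (y ∈ Y ↔ x ∈ X)) : Definable L Y := by
  obtain ⟨C, hC, φ, rfl⟩ := hX
  obtain ⟨φ', hφ'⟩ := φ.exists_relabel.{_, _, w} (τ := paramSort τ C)
    (Sum.map ρ id) (by
      rintro (i | c)
      · exact h i
      · rfl)
  refine ⟨C, hC, φ', Set.ext fun y => ?_⟩
  have hx : ∀ i, HEq (cast (congrArg M (h i)) (y (ρ i))) (y (ρ i)) := fun i => cast_heq _ _
  rw [hXY (fun i => cast (congrArg M (h i)) (y (ρ i))) y hx]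
  refine (hφ' M _ _ ?_).symm
  rintro (i | c)
  · exact hx i
  · rfl

theorem Definable.preimage {α β : Type} {τ : β → L.Sorts} (ρ : α → β)
    {X : Set ((i : α) → M (τ (ρ i)))} (hX : Definable L (σ := fun i => τ (ρ i)) X) :
    Definable L (σ := τ) {y | (fun i => y (ρ i)) ∈ X} :=
  hX.relabel ρ (fun _ => rfl) fun x y hxy => by
    have : x = fun i => y (ρ i) := funext fun i => eq_of_heq (hxy i)
    rw [this]; rfl

variable {α : Type} {σ : α → L.Sorts} {X Y : Set ((i : α) → M (σ i))}

theorem Definable.empty : Definable L (∅ : Set ((i : α) → M (σ i))) :=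
  ⟨∅, Set.finite_empty, .falsum, by simp [Formula.Realize]⟩

theorem Definable.imp (hX : Definable L X) (hY : Definable L Y) :
    Definable L {x | x ∈ X → x ∈ Y} := by
  obtain ⟨C, hC, hX⟩ := hX.exists_formula
  obtain ⟨C', hC', hY⟩ := hY.exists_formula
  obtain ⟨φ, hφ⟩ := hX _ Set.subset_union_left
  obtain ⟨ψ, hψ⟩ := hY _ Set.subset_union_right
  refine ⟨C ∪ C', hC.union hC', .imp φ ψ, ?_⟩
  rw [hφ, hψ]
  rfl

theorem Definable.compl (hX : Definable L X) : Definable L Xᶜ :=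
  hX.imp .empty

theorem Definable.univ : Definable L (Set.univ : Set ((i : α) → M (σ i))) := by
  simpa using (Definable.empty (L := L) (σ := σ)).compl

theorem Definable.inter (hX : Definable L X) (hY : Definable L Y) : Definable L (X ∩ Y) := by
  convert (hX.imp hY.compl).compl using 1
  ext x; simp

theorem Definable.diff (hX : Definable L X) (hY : Definable L Y) : Definable L (X \ Y) :=
  hX.inter hY.compl

theorem Definable.iInter {ι : Type*} [Finite ι] {X : ι → Set ((i : α) → M (σ i))}
    (hX : ∀ k, Definable L (X k)) : Definable L (⋂ k, X k) := by
  have key : ∀ s : Set ι, s.Finite → Definable L (⋂ k ∈ s, X k) := by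
    intro s hs
    induction s, hs using Set.Finite.induction_on with
    | empty => simpa using Definable.univ
    | insert _ _ ih => simpa using (hX _).inter ih
  simpa using key Set.univ Set.finite_univ

theorem Definable.coord_eq (i : α) (c : M (σ i)) :
    Definable L {x : (i : α) → M (σ i) | x i = c} :=
  ⟨{⟨σ i, c⟩}, Set.finite_singleton _,
    .equal (.var (.inl i)) (.var (σ := paramSort σ {⟨σ i, c⟩}) (.inr ⟨_, rfl⟩)), rfl⟩

theorem Definable.all {s : L.Sorts} {X : Set ((i : Option α) → M (extendSort σ s i))}
    (hX : Definable L X) : Definable L {x | ∀ y : M s, extendVal x y ∈ X} := by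
  obtain ⟨C, hC, φ, rfl⟩ := hX
  obtain ⟨φ', hφ'⟩ := φ.exists_relabel.{_, _, w} (τ := extendSort (paramSort σ C) s)
    (Sum.elim (Option.map Sum.inl) fun c => some (.inr c)) (by
      rintro ((_ | i) | c) <;> rfl)
  refine ⟨C, hC, .all s φ', Set.ext fun x => ?_⟩
  simp only [Set.mem_ofPred_eq, Formula.Realize]
  refine forall_congr' fun y => (hφ' M _ _ ?_).symm
  rintro ((_ | i) | c) <;> rfl

/-- The assignment on a disjoint union of sets of variables. -/
def sumVal {α β : Type} {σ : α → L.Sorts} {τ : β → L.Sorts} (x : (i : α) → M (σ i))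
    (y : (i : β) → M (τ i)) : (i : α ⊕ β) → M (Sum.elim σ τ i)
  | .inl i => x i
  | .inr i => y i

/-- Formulas bind one variable at a time: for a block `Option β`, the variable `none` is first moved
into the context, the rest is quantified by induction, and then it is bound. -/
theorem Definable.all_block {β : Type} [Finite β] {τ : β → L.Sorts}
    {X : Set ((i : α ⊕ β) → M (Sum.elim σ τ i))} (hX : Definable L X) :
    Definable L {x | ∀ y : (i : β) → M (τ i), sumVal x y ∈ X} := by
  revert α
  induction β using Finite.induction_empty_option with
  | @of_equiv β β' e ih =>
    intro α σ X hX
    have := @ih (fun i => τ (e i)) α σ {x | sumVal (fun i => x (.inl i))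
      (fun j => cast (by simp) (x (.inr (e.symm j)))) ∈ X}
      (hX.relabel (Sum.map id e.symm) (by rintro (i | j) <;> simp) (by
        intro x y hxy
        have : (sumVal (fun i => y (.inl i))
          (fun j => cast (by simp) (y (.inr (e.symm j))))) = x := by
          funext i
          rcases i with i | j
          · exact (eq_of_heq (hxy (.inl i))).symm
          · exact eq_of_heq ((cast_heq _ _).trans (hxy (.inr j)).symm)
        rw [Set.mem_ofPred_eq, this]
        exact Iff.rfl))
    convert this using 1
    ext x
    constructor
    · exact fun h y => h _
    · intro h y
      refine (congrArg (· ∈ X) (funext fun i => ?_)).mpr (h fun i => y (e i))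
      rcases i with i | j
      · rfl
      · refine eq_of_heq ?_
        change HEq (y j) (cast _ (y (e (e.symm j))))
        refine HEq.trans ?_ (cast_heq _ _).symm
        rw [e.apply_symm_apply]
  | h_empty =>
    intro α σ X hX
    refine hX.relabel (Sum.elim id PEmpty.elim) (by rintro (i | ⟨⟨⟩⟩); rfl) ?_
    intro x y hxy
    have : ∀ z, sumVal y z = x := by
      intro z
      funext i
      rcases i with i | ⟨⟨⟩⟩
      exact (eq_of_heq (hxy (.inl i))).symm
    simp only [Set.mem_ofPred_eq, this, forall_const]
  | @h_option β _ ih =>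
    intro α σ X hX
    have := (@ih (fun i => τ (some i)) (Option α) (extendSort σ (τ none))
      {x | sumVal (fun i => x (.inl (some i))) (fun j => match j with
        | none => x (.inl none)
        | some j => x (.inr j)) ∈ X} (hX.relabel (Sum.elim (fun i => .inl (some i))
          (fun j => match j with
            | none => .inl none
            | some j => .inr j)) (by rintro (i | _ | j) <;> rfl) (by
        intro x y hxy
        have : (sumVal (fun i => y (.inl (some i))) (fun j => match j with
          | none => y (.inl none)
          | some j => y (.inr j))) = x := by
          funext i
          rcases i with i | _ | j
          · exact (eq_of_heq (hxy (.inl i))).symm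
          · exact (eq_of_heq (hxy (.inr none))).symm
          · exact (eq_of_heq (hxy (.inr (some j)))).symm
        rw [Set.mem_ofPred_eq, this]
        exact Iff.rfl))).all
    convert this using 1
    ext x
    constructor
    · exact fun h y z => h _
    · intro h y
      refine (congrArg (· ∈ X) (funext fun i => ?_)).mpr (h (y none) fun j => y (some j))
      rcases i with i | _ | j <;> rfl

theorem Definable.ex_block {β : Type} [Finite β] {τ : β → L.Sorts}
    {X : Set ((i : α ⊕ β) → M (Sum.elim σ τ i))} (hX : Definable L X) :
    Definable L {x | ∃ y : (i : β) → M (τ i), sumVal x y ∈ X} := by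
  convert hX.compl.all_block.compl using 1
  ext x; simp

end Definable

namespace DefinableGroup

/-! ### Definable relations on a definable group. -/

section Predicates

variable {L : MSLanguage.{u, v}} {M : L.Sorts → Type w} [L.Structure M]

/-- The tuple of coordinates of a tuple of elements of a definable group. -/
def coords (G : DefinableGroup L M) {ι : Type} (x : ι → G) :
    (p : ι × Fin G.n) → M (G.sort p.2) :=
  fun p => (x p.1).1 p.2

theorem coords_injective (G : DefinableGroup L M) {ι : Type} :
    Function.Injective (G.coords (ι := ι)) := fun _ _ h =>
  funext fun k => Subtype.ext <| funext fun i => congrFun h (k, i)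

/-- Definable relations on a definable group. -/
def DefinablePred (G : DefinableGroup L M) {ι : Type} (P : (ι → G) → Prop) : Prop :=
  Definable L (σ := fun p : ι × Fin G.n => G.sort p.2) (G.coords '' {x | P x})

variable {G : DefinableGroup L M} {ι κ : Type} {P Q : (ι → G) → Prop}

theorem mem_range_coords {z : (p : ι × Fin G.n) → M (G.sort p.2)} :
    z ∈ Set.range (G.coords (ι := ι)) ↔ ∀ k, (fun i => z (k, i)) ∈ G.carrier := by
  constructor
  · rintro ⟨x, rfl⟩ k
    exact (x k).2
  · exact fun h => ⟨fun k => ⟨_, h k⟩, rfl⟩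

theorem definable_range_coords [Finite ι] :
    Definable L (σ := fun p : ι × Fin G.n => G.sort p.2) (Set.range (G.coords (ι := ι))) := by
  have : Set.range (G.coords (ι := ι)) = ⋂ k : ι, {z | (fun i => z (k, i)) ∈ G.carrier} := by
    ext z
    rw [mem_range_coords, Set.mem_iInter]
    rfl
  rw [this]
  exact Definable.iInter fun k =>
    G.definable_carrier.preimage (τ := fun p : ι × Fin G.n => G.sort p.2) (fun i => (k, i))

theorem DefinablePred.not [Finite ι] (hP : G.DefinablePred P) :
    G.DefinablePred fun x => ¬ P x := by
  have : G.coords '' {x | ¬ P x} = Set.range G.coords \ G.coords '' {x | P x} :=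
    Set.image_compl_eq_range_sdiff_image G.coords_injective _
  rw [DefinablePred, this]
  exact definable_range_coords.diff hP

theorem DefinablePred.and (hP : G.DefinablePred P) (hQ : G.DefinablePred Q) :
    G.DefinablePred fun x => P x ∧ Q x := by
  have : G.coords '' {x | P x ∧ Q x} = G.coords '' {x | P x} ∩ G.coords '' {x | Q x} :=
    Set.image_inter G.coords_injective
  rw [DefinablePred, this]
  exact Definable.inter hP hQ

theorem DefinablePred.or [Finite ι] (hP : G.DefinablePred P) (hQ : G.DefinablePred Q) :
    G.DefinablePred fun x => P x ∨ Q x := by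
  simpa only [not_and_or, not_not] using (hP.not.and hQ.not).not

theorem DefinablePred.imp [Finite ι] (hP : G.DefinablePred P) (hQ : G.DefinablePred Q) :
    G.DefinablePred fun x => P x → Q x := by
  simpa only [imp_iff_not_or] using hP.not.or hQ

theorem DefinablePred.true [Finite ι] : G.DefinablePred fun _ : ι → G => True := by
  have : G.coords '' {x : ι → G | True} = Set.range G.coords := by ext; simp
  rw [DefinablePred, this]
  exact definable_range_coords

theorem DefinablePred.forall_mem {J : Type*} {P : J → (ι → G) → Prop} [Finite ι] [Finite J]
    (hP : ∀ j, G.DefinablePred (P j)) : G.DefinablePred fun x => ∀ j, P j x := by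
  have key : ∀ s : Set J, s.Finite → G.DefinablePred fun x => ∀ j ∈ s, P j x := by
    intro s hs
    induction s, hs using Set.Finite.induction_on with
    | empty => simpa using DefinablePred.true
    | insert _ _ ih => simpa using (hP _).and ih
  simpa using key Set.univ Set.finite_univ

theorem DefinablePred.exists_mem {J : Type*} {P : J → (ι → G) → Prop} [Finite ι] [Finite J]
    (hP : ∀ j, G.DefinablePred (P j)) : G.DefinablePred fun x => ∃ j, P j x := by
  simpa using (DefinablePred.forall_mem fun j => (hP j).not).not

theorem DefinablePred.comp [Finite κ] (hP : G.DefinablePred P) (f : ι → κ) :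
    G.DefinablePred fun y : κ → G => P (y ∘ f) := by
  have : G.coords '' {y : κ → G | P (y ∘ f)} = Set.range G.coords ∩
      {z | (fun p : ι × Fin G.n => z (f p.1, p.2)) ∈ G.coords '' {x | P x}} := by
    ext z
    constructor
    · rintro ⟨y, hy, rfl⟩
      exact ⟨⟨y, rfl⟩, _, hy, rfl⟩
    · rintro ⟨⟨y, rfl⟩, x, hx, hxy⟩
      have : x = y ∘ f := G.coords_injective hxy
      exact ⟨y, show P (y ∘ f) from this ▸ hx, rfl⟩
  rw [DefinablePred, this]
  exact definable_range_coords.inter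
    (Definable.preimage (τ := fun p : κ × Fin G.n => G.sort p.2)
      (fun p : ι × Fin G.n => (f p.1, p.2)) hP)

/-- Quantifying over group elements is quantifying over their coordinates, once the index pairs are
regrouped. Membership in the carrier is already part of the image under `coords`. -/
theorem DefinablePred.exists_block [Finite ι] [Finite κ] {P : (ι ⊕ κ → G) → Prop}
    (hP : G.DefinablePred P) :
    G.DefinablePred fun x : ι → G => ∃ y : κ → G, P (Sum.elim x y) := by
  have h := (Definable.relabel (α := (ι ⊕ κ) × Fin G.n) (β := ι × Fin G.n ⊕ κ × Fin G.n)
    (τ := Sum.elim (fun p : ι × Fin G.n => G.sort p.2) fun p : κ × Fin G.n => G.sort p.2)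
    hP (fun p => match p with
      | (Sum.inl k, i) => Sum.inl (k, i)
      | (Sum.inr k, i) => Sum.inr (k, i)) (by rintro ⟨k | k, i⟩ <;> rfl)
    (Y := {z | (fun p : (ι ⊕ κ) × Fin G.n => (match p with
      | (Sum.inl k, i) => z (Sum.inl (k, i))
      | (Sum.inr k, i) => z (Sum.inr (k, i)) : M (G.sort p.2))) ∈ G.coords '' {x | P x}}) (by
        intro x y hxy
        have : (fun p : (ι ⊕ κ) × Fin G.n => (match p with
            | (Sum.inl k, i) => y (Sum.inl (k, i))
            | (Sum.inr k, i) => y (Sum.inr (k, i)) : M (G.sort p.2))) = x := by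
          funext ⟨k, i⟩
          rcases k with k | k
          · exact (eq_of_heq (hxy (Sum.inl k, i))).symm
          · exact (eq_of_heq (hxy (Sum.inr k, i))).symm
        rw [Set.mem_ofPred_eq, this])).ex_block
  rw [DefinablePred]
  convert h using 1
  ext z
  constructor
  · rintro ⟨x, ⟨y, hxy⟩, rfl⟩
    refine ⟨G.coords y, Sum.elim x y, hxy, ?_⟩
    funext ⟨k, i⟩
    rcases k with k | k <;> rfl
  · rintro ⟨y, x, hx, hxy⟩
    refine ⟨x ∘ Sum.inl, ⟨x ∘ Sum.inr, ?_⟩, ?_⟩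
    · rwa [Sum.elim_comp_inl_inr]
    · funext ⟨k, i⟩
      exact congrFun hxy (Sum.inl k, i)

theorem DefinablePred.forall_block [Finite ι] [Finite κ] {P : (ι ⊕ κ → G) → Prop}
    (hP : G.DefinablePred P) :
    G.DefinablePred fun x : ι → G => ∀ y : κ → G, P (Sum.elim x y) := by
  simpa using hP.not.exists_block.not

theorem definablePred_mem_iff {Z : Set G} :
    G.DefinablePred (fun x : Unit → G => x () ∈ Z) ↔ G.IsDefinable Z := by
  constructor
  · intro h
    refine Definable.relabel h (fun p : Unit × Fin G.n => p.2) (fun _ => rfl) fun x y hxy => ?_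
    have : x = fun p : Unit × Fin G.n => y p.2 := funext fun p => eq_of_heq (hxy p)
    subst this
    constructor
    · rintro ⟨z, hz, rfl⟩
      exact ⟨fun _ => z, hz, rfl⟩
    · rintro ⟨z, hz, h⟩
      exact ⟨z (), hz, funext fun i => congrFun h ((), i)⟩
  · intro h
    refine Definable.relabel h (fun i => ((), i)) (fun _ => rfl) fun x y hxy => ?_
    have : x = fun i => y ((), i) := funext fun p => eq_of_heq (hxy p)
    subst this
    constructor
    · rintro ⟨z, hz, rfl⟩
      exact ⟨z (), hz, rfl⟩
    · rintro ⟨z, hz, h⟩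
      exact ⟨fun _ => z, hz, funext fun p => congrFun h p.2⟩

theorem definablePred_mul : G.DefinablePred fun x : Fin 3 → G => x 0 * x 1 = x 2 := by
  rw [DefinablePred]
  convert G.definable_mul using 1
  ext z
  constructor
  · rintro ⟨x, hx, rfl⟩
    exact ⟨x 0, x 1, fun i => rfl, fun i => rfl, fun i => by rw [hx.out]; rfl⟩
  · rintro ⟨x, y, h0, h1, h2⟩
    refine ⟨![x, y, x * y], rfl, ?_⟩
    funext ⟨k, i⟩
    fin_cases k
    · exact (h0 i).symm
    · exact (h1 i).symm
    · exact (h2 i).symm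

theorem isDefinable_singleton (g : G) : G.IsDefinable {g} := by
  have : Subtype.val '' {g} = ⋂ i, {x : (i : Fin G.n) → M (G.sort i) | x i = g.1 i} := by
    ext x
    simp only [Set.image_singleton, Set.mem_singleton_iff, Set.mem_iInter, Set.mem_ofPred_eq]
    exact funext_iff
  rw [IsDefinable, this]
  exact Definable.iInter fun i => Definable.coord_eq i _

end Predicates

/-! ### Definable functions and definable families of subsets. -/

section Functions

variable {L : MSLanguage.{u, v}} {M : L.Sorts → Type w} [L.Structure M]

/-- Definable functions on a definable group, given by a definable graph. -/
def DefinableFun (G : DefinableGroup L M) {ι : Type} (t : (ι → G) → G) : Prop :=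
  G.DefinablePred fun y : ι ⊕ Unit → G => t (y ∘ Sum.inl) = y (Sum.inr ())

variable {G : DefinableGroup L M} {ι κ : Type} {s t : (ι → G) → G}

theorem DefinablePred.subst [Finite ι] [Finite κ] {P : (κ → G) → Prop} (hP : G.DefinablePred P)
    {t : κ → (ι → G) → G} (ht : ∀ k, G.DefinableFun (t k)) :
    G.DefinablePred fun x => P fun k => t k x := by
  have := ((DefinablePred.forall_mem fun k => (ht k).comp
    (Sum.elim Sum.inl fun _ => Sum.inr k : ι ⊕ Unit → ι ⊕ κ)).and (hP.comp (Sum.inr : κ → ι ⊕ κ))).exists_block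
  convert this using 2 with x
  constructor
  · exact fun h => ⟨fun k => t k x, fun k => rfl, h⟩
  · rintro ⟨y, hy, h⟩
    convert h using 2 with k
    exact hy k

theorem definablePred_eq : G.DefinablePred fun x : Fin 2 → G => x 0 = x 1 := by
  have h1 : G.DefinablePred fun x : Fin 2 ⊕ Unit → G => x (Sum.inr ()) = 1 :=
    (definablePred_mem_iff.2 (isDefinable_singleton 1)).comp Sum.inr
  have h2 := (h1.and (definablePred_mul.comp ![Sum.inl 0, Sum.inr (), Sum.inl 1])).exists_block
  convert h2 using 2 with x
  constructor
  · exact fun h => ⟨fun _ => 1, rfl, by simpa using h⟩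
  · rintro ⟨y, hy, h⟩
    have hy : y () = 1 := hy
    simpa [hy] using h

theorem definableFun_proj [Finite ι] (i : ι) : G.DefinableFun fun x : ι → G => x i :=
  definablePred_eq.comp (![Sum.inl i, Sum.inr ()] : Fin 2 → ι ⊕ Unit)

theorem definableFun_const [Finite ι] (g : G) : G.DefinableFun fun _ : ι → G => g := by
  have h := (definablePred_mem_iff.2 (isDefinable_singleton g)).comp (Sum.inr : Unit → ι ⊕ Unit)
  rw [DefinableFun]
  convert h using 2 with x
  simp [eq_comm]

theorem DefinableFun.comp [Finite κ] (ht : G.DefinableFun t) (f : ι → κ) :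
    G.DefinableFun fun y => t (y ∘ f) :=
  DefinablePred.comp ht (Sum.map f id)

theorem DefinableFun.mul [Finite ι] (hs : G.DefinableFun s) (ht : G.DefinableFun t) :
    G.DefinableFun fun x => s x * t x := by
  refine (definablePred_mul.subst
    (t := ![fun y => s (y ∘ Sum.inl), fun y => t (y ∘ Sum.inl), fun y : ι ⊕ Unit → G => y (Sum.inr ())])
    fun k => ?_)
  fin_cases k
  · exact hs.comp (Sum.inl : ι → ι ⊕ Unit)
  · exact ht.comp (Sum.inl : ι → ι ⊕ Unit)
  · exact definableFun_proj _

theorem DefinablePred.mem [Finite ι] {Z : Set G} (hZ : G.IsDefinable Z) (ht : G.DefinableFun t) :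
    G.DefinablePred fun x => t x ∈ Z :=
  (definablePred_mem_iff.2 hZ).subst (t := fun _ => t) fun _ => ht

theorem DefinableFun.inv [Finite ι] (ht : G.DefinableFun t) : G.DefinableFun fun x => (t x)⁻¹ := by
  have h := DefinablePred.mem (isDefinable_singleton 1)
    ((ht.comp (Sum.inl : ι → ι ⊕ Unit)).mul (definableFun_proj (Sum.inr ())))
  rw [DefinableFun]
  convert h using 2 with x
  rw [Set.mem_singleton_iff, mul_eq_one_iff_inv_eq]

theorem DefinablePred.ex [Finite ι] {P : (ι → G) → G → Prop}
    (hP : G.DefinablePred fun x : ι ⊕ Unit → G => P (x ∘ Sum.inl) (x (Sum.inr ()))) :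
    G.DefinablePred fun x => ∃ g, P x g := by
  convert hP.exists_block using 2 with x
  exact ⟨fun ⟨g, hg⟩ => ⟨fun _ => g, hg⟩, fun ⟨y, hy⟩ => ⟨y (), hy⟩⟩

/-- Definable families of subsets of a definable group. -/
def DefinableFamily (G : DefinableGroup L M) {ι : Type} (C : (ι → G) → Set G) : Prop :=
  G.DefinablePred fun y : ι ⊕ Unit → G => y (Sum.inr ()) ∈ C (y ∘ Sum.inl)

variable {C D : (ι → G) → Set G}

theorem DefinablePred.mem_family [Finite ι] (hC : G.DefinableFamily C) (ht : G.DefinableFun t) :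
    G.DefinablePred fun x => t x ∈ C x :=
  DefinablePred.subst hC (t := Sum.elim (fun i x => x i) fun _ => t) (by
    rintro (i | _)
    · exact definableFun_proj i
    · exact ht)

theorem DefinableFamily.comp [Finite κ] (hC : G.DefinableFamily C) (f : ι → κ) :
    G.DefinableFamily fun y => C (y ∘ f) :=
  DefinablePred.comp hC (Sum.map f id)

theorem DefinableFamily.const [Finite ι] {Z : Set G} (hZ : G.IsDefinable Z) :
    G.DefinableFamily fun _ : ι → G => Z :=
  DefinablePred.mem hZ (definableFun_proj _)

theorem DefinableFamily.inter (hC : G.DefinableFamily C) (hD : G.DefinableFamily D) :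
    G.DefinableFamily fun x => C x ∩ D x :=
  DefinablePred.and hC hD

theorem DefinableFamily.mul [Finite ι] (hC : G.DefinableFamily C) (hD : G.DefinableFamily D) :
    G.DefinableFamily fun x => C x * D x := by
  let f : ι → (ι ⊕ Unit) ⊕ Unit := fun i => Sum.inl (Sum.inl i)
  have h := DefinablePred.ex (ι := ι ⊕ Unit)
    (P := fun y g => g ∈ C (y ∘ Sum.inl) ∧ g⁻¹ * y (Sum.inr ()) ∈ D (y ∘ Sum.inl))
    (.and (.mem_family (hC.comp f) (definableFun_proj (Sum.inr ())))
      (.mem_family (hD.comp f)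
        ((definableFun_proj (Sum.inr ())).inv.mul (definableFun_proj (Sum.inl (Sum.inr ()))))))
  rw [DefinableFamily]
  convert h using 2 with y
  exact ⟨fun ⟨c, hc, d, hd, h⟩ => ⟨c, hc, by
    have h : c * d = _ := h
    simpa [← h] using hd⟩,
    fun ⟨c, hc, hd⟩ => ⟨c, hc, _, hd, by simp⟩⟩

theorem DefinableFamily.smul [Finite ι] (hC : G.DefinableFamily C) (ht : G.DefinableFun t) :
    G.DefinableFamily fun x => t x • C x := by
  have h := DefinablePred.mem_family (hC.comp (Sum.inl : ι → ι ⊕ Unit))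
    ((ht.comp (Sum.inl : ι → ι ⊕ Unit)).inv.mul (definableFun_proj (Sum.inr ())))
  rw [DefinableFamily]
  convert h using 2 with y
  rw [Set.mem_smul_set_iff_inv_smul_mem, smul_eq_mul]

end Functions

/-! ### Closure properties of definable subsets of the group. -/

section Sets

variable {L : MSLanguage.{u, v}} {M : L.Sorts → Type w} [L.Structure M]
  {G : DefinableGroup L M} {X Y : Set G}

theorem DefinableFamily.isDefinable {ι : Type} [Finite ι] {C : (ι → G) → Set G}
    (hC : G.DefinableFamily C) (x : ι → G) : G.IsDefinable (C x) :=
  definablePred_mem_iff.1 (DefinablePred.subst hC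
    (t := Sum.elim (fun i _ => x i) fun i y => y i) (by
      rintro (i | i)
      · exact definableFun_const _
      · exact definableFun_proj _))

theorem IsDefinable.inter (hX : G.IsDefinable X) (hY : G.IsDefinable Y) :
    G.IsDefinable (X ∩ Y) :=
  definablePred_mem_iff.1 ((definablePred_mem_iff.2 hX).and (definablePred_mem_iff.2 hY))

theorem IsDefinable.union (hX : G.IsDefinable X) (hY : G.IsDefinable Y) :
    G.IsDefinable (X ∪ Y) :=
  definablePred_mem_iff.1 ((definablePred_mem_iff.2 hX).or (definablePred_mem_iff.2 hY))

theorem IsDefinable.compl (hX : G.IsDefinable X) : G.IsDefinable Xᶜ :=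
  definablePred_mem_iff.1 (definablePred_mem_iff.2 hX).not

theorem IsDefinable.diff (hX : G.IsDefinable X) (hY : G.IsDefinable Y) :
    G.IsDefinable (X \ Y) :=
  hX.inter hY.compl

theorem IsDefinable.iUnion {J : Type*} [Finite J] {X : J → Set G}
    (hX : ∀ j, G.IsDefinable (X j)) : G.IsDefinable (⋃ j, X j) := by
  have := DefinablePred.exists_mem fun j => definablePred_mem_iff.2 (hX j)
  exact definablePred_mem_iff.1 (by simpa only [Set.mem_iUnion] using this)

theorem IsDefinable.iInter {J : Type*} [Finite J] {X : J → Set G}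
    (hX : ∀ j, G.IsDefinable (X j)) : G.IsDefinable (⋂ j, X j) := by
  have := DefinablePred.forall_mem fun j => definablePred_mem_iff.2 (hX j)
  exact definablePred_mem_iff.1 (by simpa only [Set.mem_iInter] using this)

theorem IsDefinable.mul (hX : G.IsDefinable X) (hY : G.IsDefinable Y) :
    G.IsDefinable (X * Y) :=
  ((DefinableFamily.const (ι := Empty) hX).mul (.const hY)).isDefinable Empty.elim

theorem IsDefinable.smul (g : G) (hX : G.IsDefinable X) : G.IsDefinable (g • X) :=
  ((DefinableFamily.const (ι := Empty) hX).smul (definableFun_const g)).isDefinable Empty.elim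

theorem IsDefinable.inv (hX : G.IsDefinable X) : G.IsDefinable X⁻¹ :=
  definablePred_mem_iff.1 (DefinablePred.mem hX (definableFun_proj ()).inv :
    G.DefinablePred fun x : Unit → G => (x ())⁻¹ ∈ X)

theorem IsDefinable.pow (hX : G.IsDefinable X) (n : ℕ) : G.IsDefinable (X ^ n) := by
  induction n with
  | zero => exact isDefinable_singleton 1
  | succ n ih => exact pow_succ X n ▸ ih.mul hX

end Sets

/-! ### Compactness for directed families of definable sets. -/

section Saturation

variable {L : MSLanguage.{u, v}} {M : L.Sorts → Type w} [L.Structure M]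
  {G : DefinableGroup L M} {κ : Cardinal.{w}}

/-- Each set uses finitely many parameters, so all together use at most `#J * ℵ₀ < κ`; here
uncountability of `κ` enters. Directedness gives finite satisfiability. -/
theorem nonempty_iInter_of_directed (hκ : ℵ₀ < κ) (hM : IsSaturated L M κ) {J : Type w}
    [Nonempty J] (hJ : #J < κ) {W : J → Set G} (hW : ∀ j, G.IsDefinable (W j))
    (hdir : Directed (· ⊇ ·) W) (hne : ∀ j, (W j).Nonempty) : (⋂ j, W j).Nonempty := by
  choose C hC φ hφ using fun j => Definable.exists_formula (hW j)
  set D : Set (Σ s, M s) := ⋃ j, C j with hD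
  have hCD : ∀ j, C j ⊆ D := fun j => Set.subset_iUnion C j
  have hcard : #D < Cardinal.lift.{u} κ := by
    have h1 : #D ≤ Cardinal.sum fun j => #(C j) := by
      have := Cardinal.mk_iUnion_le_sum_mk_lift (f := C)
      rwa [Cardinal.lift_id'.{w, max u w}] at this
    have h2 : (Cardinal.sum fun j => #(C j)) ≤ Cardinal.lift.{u} #J * ℵ₀ := by
      refine (Cardinal.sum_le_sum _ (fun _ => ℵ₀) fun j => (hC j).countable.le_aleph0).trans ?_
      rw [Cardinal.sum_const, Cardinal.lift_aleph0, ← Cardinal.lift_umax.{w, u}]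
    refine (h1.trans h2).trans_lt ?_
    have h3 : Cardinal.lift.{u} #J < Cardinal.lift.{u} κ := Cardinal.lift_lt.2 hJ
    have h4 : ℵ₀ < Cardinal.lift.{u} κ := by simpa using hκ
    exact Cardinal.mul_lt_of_lt h4.le h3 h4
  obtain ⟨x, hx⟩ := hM D hcard G.n G.sort (Set.range fun j => φ j D (hCD j)) (by
    intro Ψ hΨ hfin
    obtain ⟨s, rfl⟩ : ∃ s : Finset J, Ψ = (fun j => φ j D (hCD j)) '' s := by
      rw [← Set.image_univ] at hΨ
      obtain ⟨s, -, rfl⟩ := Set.subset_image_iff.1 hΨ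
      obtain ⟨t, -, ht⟩ := Set.exists_subset_image_finite_and.1
        ⟨_, subset_rfl, hfin, (rfl : (fun j => φ j D (hCD j)) '' s = _)⟩
      exact ⟨ht.1.toFinset, by rw [Set.Finite.coe_toFinset, ht.2]⟩
    obtain ⟨j, hj⟩ := hdir.finset_le s
    obtain ⟨g, hg⟩ := hne j
    refine ⟨g.1, ?_⟩
    rintro _ ⟨i, hi, rfl⟩
    have : g.1 ∈ Subtype.val '' W i := ⟨g, hj i hi hg, rfl⟩
    rw [hφ i D (hCD i)] at this
    exact this)
  have key : ∀ j, x ∈ Subtype.val '' W j := fun j => by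
    rw [hφ j D (hCD j)]
    exact hx _ ⟨j, rfl⟩
  obtain ⟨g, -, rfl⟩ := key (Classical.arbitrary J)
  refine ⟨g, Set.mem_iInter.2 fun j => ?_⟩
  obtain ⟨g', hg', h⟩ := key j
  exact Subtype.ext h ▸ hg'

/-- The possible left factors `X j ∩ g • (Y j)⁻¹` of a given `g` form a directed family of nonempty
definable sets; a common point factors `g` for all `j` at once. -/
theorem iInter_mul_subset (hκ : ℵ₀ < κ) (hM : IsSaturated L M κ) {J : Type w} [Preorder J]
    [IsDirectedOrder J] [Nonempty J] (hJ : #J < κ) {X Y : J → Set G}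
    (hX : ∀ j, G.IsDefinable (X j)) (hY : ∀ j, G.IsDefinable (Y j)) (hX' : Antitone X)
    (hY' : Antitone Y) : ⋂ j, X j * Y j ⊆ (⋂ j, X j) * ⋂ j, Y j := by
  intro g hg
  have h := nonempty_iInter_of_directed hκ hM hJ (W := fun j => X j ∩ g • (Y j)⁻¹)
    (fun j => (hX j).inter ((hY j).inv.smul g)) (by
      intro i j
      obtain ⟨k, hik, hjk⟩ := exists_ge_ge i j
      refine ⟨k, ?_, ?_⟩
      · exact Set.inter_subset_inter (hX' hik) (Set.smul_set_mono (Set.inv_subset_inv.2 (hY' hik)))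
      · exact Set.inter_subset_inter (hX' hjk) (Set.smul_set_mono (Set.inv_subset_inv.2 (hY' hjk))))
    (fun j => by
      obtain ⟨x, hx, y, hy, h⟩ := Set.mem_iInter.1 hg j
      refine ⟨x, hx, y⁻¹, Set.inv_mem_inv.2 hy, ?_⟩
      have h : x * y = g := h
      simp [← h])
  obtain ⟨x, hx⟩ := h
  rw [Set.mem_iInter] at hx
  refine ⟨x, Set.mem_iInter.2 fun j => (hx j).1, x⁻¹ * g, Set.mem_iInter.2 fun j => ?_, by simp⟩
  obtain ⟨y, hy, h⟩ := (hx j).2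
  have h : g * y = x := h
  simpa [← h] using hy

end Saturation

/-! ### Thick sets and Ramsey's theorem. -/

section Thick

variable {L : MSLanguage.{u, v}} {M : L.Sorts → Type w} [L.Structure M]
  {G : DefinableGroup L M} {t t' : ℕ} {X Y Z Y' : Set G}

theorem IsThickWith.mono_left (h : G.IsThickWith t Y X) (hY : Y ⊆ Y') : G.IsThickWith t Y' X :=
  fun g hg => let ⟨i, j, hij, h⟩ := h g hg; ⟨i, j, hij, hY h⟩

theorem IsThickWith.inv (h : G.IsThickWith t Y X) : G.IsThickWith t Y⁻¹ X := by
  intro g hg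
  obtain ⟨i, j, hij, h⟩ := h (g ∘ Fin.rev) fun i => hg _
  exact ⟨j.rev, i.rev, Fin.rev_lt_rev.2 hij, by simpa using h⟩

theorem IsThickWith.one_mem (h : G.IsThickWith t Y X) (hX : X.Nonempty) : 1 ∈ Y := by
  obtain ⟨x, hx⟩ := hX
  obtain ⟨i, j, -, h⟩ := h (fun _ => x) fun _ => hx
  simpa using h

/-- Ramsey's theorem for pairs and two colours, in a form suited to sequences. -/
theorem exists_homogeneous_strictMono (p q : ℕ) : ∃ n : ℕ, ∀ s : Finset ℕ, n ≤ s.card →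
    ∀ R : ℕ → ℕ → Prop,
      (∃ f : Fin p → ℕ, StrictMono f ∧ (∀ i, f i ∈ s) ∧ ∀ i j, i < j → R (f i) (f j)) ∨
      (∃ f : Fin q → ℕ, StrictMono f ∧ (∀ i, f i ∈ s) ∧ ∀ i j, i < j → ¬ R (f i) (f j)) := by
  classical
  induction p generalizing q with
  | zero => exact ⟨0, fun s _ R => .inl ⟨Fin.elim0, fun i => i.elim0, fun i => i.elim0,
      fun i => i.elim0⟩⟩
  | succ p ihp =>
    induction q with
    | zero => exact ⟨0, fun s _ R => .inr ⟨Fin.elim0, fun i => i.elim0, fun i => i.elim0,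
        fun i => i.elim0⟩⟩
    | succ q ihq =>
      obtain ⟨n₁, h₁⟩ := ihp (q + 1)
      obtain ⟨n₂, h₂⟩ := ihq
      refine ⟨n₁ + n₂ + 1, fun s hs R => ?_⟩
      have hne : s.Nonempty := Finset.card_pos.1 (by omega)
      -- The rest of `s` is split by the colour of the pair with the minimum; a homogeneous sequence
      -- of that colour in the larger part is prolonged by `m`.
      set m := s.min' hne
      have hm : m ∈ s := s.min'_mem hne
      have hlt : ∀ x ∈ s.erase m, m < x := fun x hx => s.min'_lt_of_mem_erase_min' hne hx
      have hcard : (s.erase m).card + 1 = s.card := Finset.card_erase_add_one hm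
      have hsplit := Finset.card_filter_add_card_filter_not (s := s.erase m) (fun x => R m x)
      have hcons : ∀ {k : ℕ} {f : Fin k → ℕ} {Q : ℕ → ℕ → Prop}, StrictMono f →
          (∀ i, f i ∈ s.erase m) → (∀ i, Q m (f i)) → (∀ i j, i < j → Q (f i) (f j)) →
          ∃ f : Fin (k + 1) → ℕ, StrictMono f ∧ (∀ i, f i ∈ s) ∧
            ∀ i j, i < j → Q (f i) (f j) := by
        intro k f Q hf hfs hQm hQ
        refine ⟨Fin.cons m f, ?_, ?_, ?_⟩
        · intro i j hij
          induction i using Fin.cases with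
          | zero =>
            induction j using Fin.cases with
            | zero => exact absurd hij (lt_irrefl _)
            | succ j => simpa using hlt _ (hfs j)
          | succ i =>
            induction j using Fin.cases with
            | zero => exact absurd hij (by simp)
            | succ j => simpa using hf (Fin.succ_lt_succ_iff.1 hij)
        · intro i
          induction i using Fin.cases with
          | zero => exact hm
          | succ i => exact Finset.mem_of_mem_erase (hfs i)
        · intro i j hij
          induction i using Fin.cases with
          | zero =>
            induction j using Fin.cases with
            | zero => exact absurd hij (lt_irrefl _)
            | succ j => simpa using hQm j
          | succ i =>
            induction j using Fin.cases with
            | zero => exact absurd hij (by simp)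
            | succ j => simpa using hQ _ _ (Fin.succ_lt_succ_iff.1 hij)
      by_cases hc : n₁ ≤ ((s.erase m).filter fun x => R m x).card
      · rcases h₁ _ hc R with ⟨f, hf, hfs, hR⟩ | ⟨f, hf, hfs, hR⟩
        · exact .inl (hcons hf (fun i => (Finset.mem_filter.1 (hfs i)).1)
            (fun i => (Finset.mem_filter.1 (hfs i)).2) hR)
        · exact .inr ⟨f, hf, fun i => Finset.mem_of_mem_erase (Finset.mem_filter.1 (hfs i)).1, hR⟩
      · have hc' : n₂ ≤ ((s.erase m).filter fun x => ¬ R m x).card := by omega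
        rcases h₂ _ hc' R with ⟨f, hf, hfs, hR⟩ | ⟨f, hf, hfs, hR⟩
        · exact .inl ⟨f, hf, fun i => Finset.mem_of_mem_erase (Finset.mem_filter.1 (hfs i)).1, hR⟩
        · exact .inr (hcons (Q := fun x y => ¬ R x y) hf
            (fun i => (Finset.mem_filter.1 (hfs i)).1)
            (fun i => (Finset.mem_filter.1 (hfs i)).2) hR)

-- Colour the pairs `k < l` by whether `(g k)⁻¹ * g l` avoids `Y`. A long sequence avoiding `Y` is
-- impossible, and one staying in `Y` must hit `Y'`. The bound depends on `t` and `t'` alone, which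
-- keeps `IsLarge` uniform.
variable (G) in
theorem exists_isThickWith_inter (t t' : ℕ) : ∃ n : ℕ, ∀ X Y Y' : Set G,
    G.IsThickWith t Y X → G.IsThickWith t' Y' X → G.IsThickWith n (Y ∩ Y') X := by
  obtain ⟨n, hn⟩ := exists_homogeneous_strictMono (t + 1) (t' + 1)
  refine ⟨n, fun X Y Y' hY hY' g hg => ?_⟩
  by_contra! hcon
  have hext : ∀ k, k ∈ Finset.range (n + 1) → (Fin.ofNat (n + 1) k).1 = k := fun k hk =>
    Nat.mod_eq_of_lt (Finset.mem_range.1 hk)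
  have hlt : ∀ {k l}, k ∈ Finset.range (n + 1) → l ∈ Finset.range (n + 1) → k < l →
      Fin.ofNat (n + 1) k < Fin.ofNat (n + 1) l := fun hk hl hkl =>
    Fin.lt_def.2 (by rw [hext _ hk, hext _ hl]; exact hkl)
  rcases hn (Finset.range (n + 1)) (by simp) (fun k l =>
    (g (Fin.ofNat (n + 1) k))⁻¹ * g (Fin.ofNat (n + 1) l) ∉ Y) with
    ⟨f, hf, hfs, hR⟩ | ⟨f, hf, hfs, hR⟩
  · obtain ⟨i, j, hij, h⟩ := hY (fun i => g (Fin.ofNat (n + 1) (f i))) fun i => hg _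
    exact hR i j hij h
  · obtain ⟨i, j, hij, h⟩ := hY' (fun i => g (Fin.ofNat (n + 1) (f i))) fun i => hg _
    exact hcon _ _ (hlt (hfs i) (hfs j) (hf hij)) ⟨not_not.1 (hR i j hij), h⟩

theorem IsThickWith.inter (h : G.IsThickWith t Y X) (h' : G.IsThickWith t' Y' X) :
    ∃ n, G.IsThickWith n (Y ∩ Y') X :=
  let ⟨n, hn⟩ := exists_isThickWith_inter G t t'
  ⟨n, hn _ _ _ h h'⟩

theorem exists_isThickWith_biInter {J : Type*} {W : J → Set G} (s : Finset J)
    (h : ∀ j ∈ s, ∃ t, G.IsThickWith t (W j) X) : ∃ t, G.IsThickWith t (⋂ j ∈ s, W j) X := by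
  classical
  induction s using Finset.induction_on with
  -- Even the whole group is not `0`-thick in a nonempty set: a pair `i < j` needs two indices.
  | empty => exact ⟨1, fun g _ => ⟨0, 1, by simp, by simp⟩⟩
  | insert j s _ ih =>
    obtain ⟨t, ht⟩ := h j (by simp)
    obtain ⟨t', ht'⟩ := ih fun k hk => h k (Finset.mem_insert_of_mem hk)
    simpa using ht.inter ht'

/-- A set that is thick in `X` covers `X` by finitely many translates. -/
theorem IsThickWith.exists_cover (h : G.IsThickWith t Y X) :
    ∃ (n : ℕ) (g : Fin n → G), (∀ i, g i ∈ X) ∧ X ⊆ ⋃ i, g i • Y := by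
  by_contra! hcon
  have : ∀ n : ℕ, ∃ g : Fin n → G, (∀ i, g i ∈ X) ∧ ∀ i j, i < j → (g i)⁻¹ * g j ∉ Y := by
    intro n
    induction n with
    | zero => exact ⟨Fin.elim0, fun i => i.elim0, fun i => i.elim0⟩
    | succ n ih =>
      obtain ⟨g, hg, hgY⟩ := ih
      obtain ⟨x, hx, hxg⟩ := Set.not_subset.1 (hcon n g hg)
      refine ⟨Fin.snoc g x, ?_, ?_⟩
      · intro i
        induction i using Fin.lastCases with
        | last => simpa using hx
        | cast i => simpa using hg i
      · intro i j hij
        induction j using Fin.lastCases with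
        | last =>
          induction i using Fin.lastCases with
          | last => exact absurd hij (lt_irrefl _)
          | cast i =>
            intro hmem
            refine hxg (Set.mem_iUnion.2 ⟨i, Set.mem_smul_set_iff_inv_smul_mem.2 ?_⟩)
            simpa using hmem
        | cast j =>
          induction i using Fin.lastCases with
          | last => exact absurd hij (not_lt.2 (Fin.le_last _))
          | cast i => simpa using hgY i j (by simpa using hij)
  obtain ⟨g, hg, hgY⟩ := this (t + 1)
  obtain ⟨i, j, hij, h⟩ := h g hg
  exact hgY i j hij h

/-- By saturation a definable superset of the intersection contains a finite subintersection, which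
is thick by Ramsey's theorem. -/
theorem isThick_sInter {κ : Cardinal.{w}} (hκ : ℵ₀ < κ) (hM : IsSaturated L M κ)
    {F : Set (Set G)} (hF : #F < κ) (hdef : ∀ Z ∈ F, G.IsDefinable Z)
    (hthick : ∀ Z ∈ F, ∃ t, G.IsThickWith t Z X) : G.IsThick (⋂₀ F) X := by
  classical
  intro Z hZ hFZ
  have hcard : #(Finset F) < κ := by
    cases finite_or_infinite F
    · exact (Cardinal.mk_lt_aleph0).trans hκ
    · rwa [Cardinal.mk_finset_of_infinite]
  have hW : ∀ s : Finset F, G.IsDefinable (⋂ Y ∈ s, (Y : Set G)) := fun s => by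
    have := IsDefinable.iInter (G := G) (J := s) (X := fun Y => Y.1.1) fun Y => hdef _ Y.1.2
    rwa [Set.iInter_subtype] at this
  obtain ⟨s, hs⟩ : ∃ s : Finset F, ⋂ Y ∈ s, (Y : Set G) ⊆ Z := by
    by_contra! hcon
    obtain ⟨g, hg⟩ := nonempty_iInter_of_directed hκ hM hcard
      (W := fun s : Finset F => (⋂ Y ∈ s, (Y : Set G)) \ Z) (fun s => (hW s).diff hZ)
      (directed_of_isDirected_le fun s s' hss' =>
        Set.sdiff_subset_sdiff_left (Set.biInter_subset_biInter_left hss'))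
      (fun s => Set.sdiff_nonempty.2 (hcon s))
    rw [Set.mem_iInter] at hg
    refine (hg ∅).2 (hFZ fun Y hY => ?_)
    simpa using (hg {⟨Y, hY⟩}).1
  obtain ⟨t, ht⟩ := exists_isThickWith_biInter s fun Y _ => hthick Y.1 Y.2
  exact ⟨t, ht.mono_left hs⟩

end Thick

/-! ### Rough measures and overlapping translates. -/

section RoughMeasure

variable {L : MSLanguage.{u, v}} {M : L.Sorts → Type w} [L.Structure M]
  {G : DefinableGroup L M} {T : Set G} {μ : Set G → ℝ≥0∞}

theorem isDefinable_empty : G.IsDefinable ∅ := by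
  have := Definable.empty (L := L) (M := M) (σ := G.sort)
  rwa [IsDefinable, Set.image_empty]

theorem IsRoughMeasure.measure_empty (hμ : G.IsRoughMeasure T μ) {X : Set G}
    (hX : G.IsDefinable X) (hfin : μ X ≠ ⊤) : μ ∅ = 0 := by
  have h : μ ∅ ≠ ⊤ :=
    ne_top_of_le_ne_top hfin (hμ.mono _ _ isDefinable_empty hX (Set.empty_subset _))
  have := hμ.additive ∅ ∅ isDefinable_empty isDefinable_empty (Set.empty_inter _)
  rw [Set.union_self] at this
  exact (ENNReal.add_right_inj h).1 (by rw [add_zero, ← this])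

theorem IsRoughMeasure.measure_union_iUnion_le (hμ : G.IsRoughMeasure T μ) {X : Set G}
    (hX : G.IsDefinable X) {n : ℕ} {Y : Fin n → Set G} (hY : ∀ i, G.IsDefinable (Y i)) :
    μ (X ∪ ⋃ i, Y i) ≤ μ X + ∑ i, μ (Y i) := by
  induction n generalizing X with
  | zero => simp
  | succ n ih =>
    have h : X ∪ ⋃ i, Y i = (X ∪ Y 0) ∪ ⋃ i : Fin n, Y i.succ := by
      ext x
      simp [Fin.exists_fin_succ, or_assoc]
    rw [h, Fin.sum_univ_succ, ← add_assoc]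
    exact (ih (hX.union (hY 0)) fun i => hY i.succ).trans
      (add_le_add_left (hμ.subadditive _ _ hX (hY 0)) _)

/-- A rough Bonferroni inequality: removing the fattened union `W * T` of the other translates from
`g 0 • C` costs at most `n * δ`, and rough additivity applies to what is left. -/
theorem IsRoughMeasure.card_mul_measure_le (hμ : G.IsRoughMeasure T μ)
    (hinv : ∀ (g : G) (Y : Set G), G.IsDefinable Y → μ (g • Y) = μ Y) (hT : G.IsDefinable T)
    {C : Set G} (hC : G.IsDefinable C) {δ : ℝ≥0∞} {n : ℕ} (g : Fin n → G)
    (hg : ∀ i j, i < j → μ (g i • C ∩ g j • (C * T)) ≤ δ) :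
    n * μ C ≤ μ (⋃ i, g i • C) + n ^ 2 * δ := by
  induction n with
  | zero => simp
  | succ n ih =>
    have hdef : ∀ x : G, G.IsDefinable (x • C) := fun x => hC.smul x
    have hdef' : ∀ x : G, G.IsDefinable (x • (C * T)) := fun x => (hC.mul hT).smul x
    set W : Set G := ⋃ i : Fin n, g i.succ • C with hW
    have hWdef : G.IsDefinable W := .iUnion fun i => hdef _
    have hWT : W * T = ⋃ i : Fin n, g i.succ • (C * T) := by
      rw [hW, Set.iUnion_mul]
      simp only [smul_mul_assoc]
    have h1 : (n : ℝ≥0∞) * μ C ≤ μ W + n ^ 2 * δ :=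
      ih (fun i => g i.succ) fun i j hij => hg _ _ (Fin.succ_lt_succ_iff.2 hij)
    have hV : G.IsDefinable (g 0 • C \ (W * T)) := (hdef _).diff (hWdef.mul hT)
    have h2 : μ C ≤ μ (g 0 • C \ (W * T)) + n * δ := by
      rw [← hinv (g 0) C hC]
      have hdef'' : ∀ i : Fin n, G.IsDefinable (g 0 • C ∩ g i.succ • (C * T)) := fun i =>
        (hdef _).inter (hdef' _)
      refine (hμ.mono _ _ (hdef _) (hV.union (.iUnion hdef'')) ?_).trans
        ((hμ.measure_union_iUnion_le hV hdef'').trans (add_le_add_right ?_ _))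
      · intro x hx
        by_cases hxW : x ∈ W * T
        · right
          rw [hWT, Set.mem_iUnion] at hxW
          obtain ⟨i, hi⟩ := hxW
          exact Set.mem_iUnion.2 ⟨i, hx, hi⟩
        · exact .inl ⟨hx, hxW⟩
      · refine (Finset.sum_le_card_nsmul _ _ δ fun i _ => hg _ _ (Fin.succ_pos i)).trans ?_
        simp
    have h3 : μ (g 0 • C \ (W * T)) + μ W ≤ μ (⋃ i, g i • C) := by
      rw [← hμ.additive _ _ hV hWdef Set.sdiff_inter_self]
      refine hμ.mono _ _ (hV.union hWdef) (.iUnion fun i => hdef _) ?_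
      rintro x (hx | hx)
      · exact Set.mem_iUnion.2 ⟨0, hx.1⟩
      · obtain ⟨i, hi⟩ := Set.mem_iUnion.1 hx
        exact Set.mem_iUnion.2 ⟨i.succ, hi⟩
    calc ((n + 1 : ℕ) : ℝ≥0∞) * μ C = n * μ C + μ C := by push_cast; ring
      _ ≤ (μ W + n ^ 2 * δ) + (μ (g 0 • C \ (W * T)) + n * δ) := add_le_add h1 h2
      _ = (μ (g 0 • C \ (W * T)) + μ W) + (n ^ 2 * δ + n * δ) := by ring
      _ ≤ μ (⋃ i, g i • C) + ((n ^ 2 * δ + n * δ) + (n + 1) * δ) :=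
        add_le_add h3 le_self_add
      _ = μ (⋃ i, g i • C) + ((n + 1 : ℕ) : ℝ≥0∞) ^ 2 * δ := by push_cast; ring

/-- With `t * δ > μ V + 1` and `δ' = 1 / (t + 1) ^ 2`, translates with all overlaps below `δ'` would
have a union of measure greater than `μ V`. Both constants are independent of `X` and `C`. -/
theorem IsRoughMeasure.exists_isThickWith_measure (hμ : G.IsRoughMeasure T μ)
    (hinv : ∀ (g : G) (Y : Set G), G.IsDefinable Y → μ (g • Y) = μ Y) (hT : G.IsDefinable T)
    {V : Set G} (hV : G.IsDefinable V) (hfin : μ V ≠ ⊤) {δ : ℝ≥0∞} (hδ : δ ≠ 0) :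
    ∃ δ' : ℝ≥0∞, δ' ≠ 0 ∧ ∃ t : ℕ, ∀ X C : Set G, G.IsDefinable C → X * C ⊆ V → δ ≤ μ C →
      G.IsThickWith t {h | δ' ≤ μ (C ∩ h • (C * T))} X := by
  obtain ⟨t, ht⟩ := ENNReal.exists_nat_mul_gt hδ (ENNReal.add_ne_top.2 ⟨hfin, ENNReal.one_ne_top⟩)
  have ht0 : ((t + 1 : ℕ) : ℝ≥0∞) ^ 2 ≠ 0 := by simp
  have ht1 : ((t + 1 : ℕ) : ℝ≥0∞) ^ 2 ≠ ⊤ := ENNReal.pow_ne_top (ENNReal.natCast_ne_top _)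
  refine ⟨(((t + 1 : ℕ) : ℝ≥0∞) ^ 2)⁻¹, ENNReal.inv_ne_zero.2 ht1, t, ?_⟩
  intro X C hC hXC hδC g hg
  by_contra! hcon
  have hsmul : ∀ i j, g i • C ∩ g j • (C * T) = g i • (C ∩ ((g i)⁻¹ * g j) • (C * T)) := by
    intro i j
    rw [Set.smul_set_inter, smul_smul, mul_inv_cancel_left]
  have h := hμ.card_mul_measure_le hinv hT hC (δ := (((t + 1 : ℕ) : ℝ≥0∞) ^ 2)⁻¹) g
    fun i j hij => by
      rw [hsmul, hinv _ _ (hC.inter ((hC.mul hT).smul _))]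
      exact (not_le.1 (hcon i j hij)).le
  rw [ENNReal.mul_inv_cancel ht0 ht1] at h
  have h1 : μ (⋃ i, g i • C) ≤ μ V := by
    refine hμ.mono _ _ (.iUnion fun i => hC.smul _) hV (Set.iUnion_subset fun i => ?_)
    rintro _ ⟨c, hc, rfl⟩
    exact hXC (Set.mul_mem_mul (hg i) hc)
  have h2 : (t : ℝ≥0∞) * δ ≤ ((t + 1 : ℕ) : ℝ≥0∞) * μ C :=
    mul_le_mul' (by exact_mod_cast t.le_succ) hδC
  exact absurd (ht.trans_le (h2.trans (h.trans (add_le_add_left h1 1)))) (lt_irrefl _)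

end RoughMeasure

/-! ### Largeness, a definable substitute for positive measure. -/

section Large

variable {L : MSLanguage.{u, v}} {M : L.Sorts → Type w} [L.Structure M]

/-- A combinatorial substitute for having measure bounded below, that is uniformly definable:
a set is large of rank `k + 1` if among sufficiently many of its translates by elements of `X`
there are two whose intersection, up to the error `T`, is large of rank `k`. -/
def IsLarge (G : DefinableGroup L M) (X T : Set G) (N : ℕ → ℕ) : ℕ → Set G → Prop
  | 0, C => C.Nonempty
  | k + 1, C => ∀ g : Fin (N k + 1) → G, (∀ i, g i ∈ X) → ∃ i j, i < j ∧
      IsLarge G X T N k (C ∩ ((g i)⁻¹ * g j) • (C * T)) ∧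
      IsLarge G X T N k (C ∩ ((g i)⁻¹ * g j)⁻¹ • (C * T))

variable {G : DefinableGroup L M} {X T : Set G} {N : ℕ → ℕ}

theorem IsLarge.mono {k : ℕ} {C C' : Set G} (h : G.IsLarge X T N k C) (hC : C ⊆ C') :
    G.IsLarge X T N k C' := by
  induction k generalizing C C' with
  | zero => exact Set.Nonempty.mono hC h
  | succ k ih =>
    intro g hg
    obtain ⟨i, j, hij, h1, h2⟩ := h g hg
    exact ⟨i, j, hij,
      ih h1 (Set.inter_subset_inter hC (Set.smul_set_mono (Set.mul_subset_mul_right hC))),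
      ih h2 (Set.inter_subset_inter hC (Set.smul_set_mono (Set.mul_subset_mul_right hC)))⟩

theorem IsLarge.of_succ {k : ℕ} {C : Set G} (h : G.IsLarge X T N (k + 1) C) (hX : X.Nonempty) :
    G.IsLarge X T N k C :=
  let ⟨_, hx⟩ := hX
  let ⟨_, _, _, h, _⟩ := h (fun _ => _) fun _ => hx
  h.mono Set.inter_subset_left

theorem IsLarge.nonempty {k : ℕ} {C : Set G} (h : G.IsLarge X T N k C) (hX : X.Nonempty) :
    C.Nonempty := by
  induction k with
  | zero => exact h
  | succ k ih => exact ih (h.of_succ hX)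

theorem IsLarge.congr {N' : ℕ → ℕ} {k : ℕ} {C : Set G} (h : G.IsLarge X T N k C)
    (hN : ∀ l < k, N l = N' l) : G.IsLarge X T N' k C := by
  induction k generalizing C with
  | zero => exact h
  | succ k ih =>
    rw [IsLarge, ← hN k k.lt_succ_self]
    intro g hg
    obtain ⟨i, j, hij, h1, h2⟩ := h g hg
    exact ⟨i, j, hij, ih h1 fun l hl => hN l (hl.trans k.lt_succ_self),
      ih h2 fun l hl => hN l (hl.trans k.lt_succ_self)⟩

/-- Because `N` fixes the number of translates tested at each rank, largeness unfolds to a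
first-order condition with finitely many quantifiers over the group. -/
theorem DefinablePred.isLarge (hX : G.IsDefinable X) (hT : G.IsDefinable T) (k : ℕ)
    {ι : Type} [Finite ι] {C : (ι → G) → Set G} (hC : G.DefinableFamily C) :
    G.DefinablePred fun x => G.IsLarge X T N k (C x) := by
  induction k generalizing ι with
  | zero => exact DefinablePred.ex hC
  | succ k ih =>
    have hfun : ∀ i j, G.DefinableFun fun y : ι ⊕ Fin (N k + 1) → G =>
        (y (Sum.inr i))⁻¹ * y (Sum.inr j) := fun i j =>
      (definableFun_proj _).inv.mul (definableFun_proj _)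
    have hC' : G.DefinableFamily fun y : ι ⊕ Fin (N k + 1) → G => C (y ∘ Sum.inl) :=
      hC.comp Sum.inl
    refine DefinablePred.forall_block (κ := Fin (N k + 1)) (P := fun y =>
      (∀ i, y (Sum.inr i) ∈ X) → ∃ i j, i < j ∧
        G.IsLarge X T N k (C (y ∘ Sum.inl) ∩
          ((y (Sum.inr i))⁻¹ * y (Sum.inr j)) • (C (y ∘ Sum.inl) * T)) ∧
        G.IsLarge X T N k (C (y ∘ Sum.inl) ∩
          ((y (Sum.inr i))⁻¹ * y (Sum.inr j))⁻¹ • (C (y ∘ Sum.inl) * T))) ?_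
    refine .imp (.forall_mem fun i => .mem hX (definableFun_proj _))
      (.exists_mem fun i => .exists_mem fun j => ?_)
    by_cases hij : i < j
    · simp only [hij, true_and]
      exact (ih (hC'.inter ((hC'.mul (.const hT)).smul (hfun i j)))).and
        (ih (hC'.inter ((hC'.mul (.const hT)).smul (hfun i j).inv)))
    · simpa only [hij, false_and, not_true_eq_false] using
        (DefinablePred.true (G := G) (ι := ι ⊕ Fin (N k + 1))).not

/-- Induction on the rank: overlaps of measure at least `δ'` occur for a thick set of `h`, and
Ramsey's theorem serves `h` and `h⁻¹` together. The bounds depend on `δ` and not on `C`, so `N` can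
be chosen first. -/
theorem IsRoughMeasure.exists_isLarge {μ : Set G → ℝ≥0∞} (hμ : G.IsRoughMeasure T μ)
    (hinv : ∀ (g : G) (Y : Set G), G.IsDefinable Y → μ (g • Y) = μ Y) (hT : G.IsDefinable T)
    {V : Set G} (hV : G.IsDefinable V) (hfin : μ V ≠ ⊤) (k : ℕ) {δ : ℝ≥0∞} (hδ : δ ≠ 0) :
    ∃ N : ℕ → ℕ, ∀ C : Set G, G.IsDefinable C → X * C ⊆ V → δ ≤ μ C →
      G.IsLarge X T N k C := by
  induction k generalizing δ with
  | zero =>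
    refine ⟨fun _ => 0, fun C hC _ hδC => Set.nonempty_iff_ne_empty.2 ?_⟩
    rintro rfl
    rw [hμ.measure_empty hV hfin] at hδC
    exact hδ (le_zero_iff.1 hδC)
  | succ k ih =>
    obtain ⟨δ', hδ', t, ht⟩ := hμ.exists_isThickWith_measure hinv hT hV hfin hδ
    obtain ⟨n, hn⟩ := exists_isThickWith_inter G t t
    obtain ⟨N, hN⟩ := ih hδ'
    -- Largeness of rank `k` reads `N` only below `k`, so the value at `k` is free.
    refine ⟨Function.update N k n, fun C hC hXC hδC => ?_⟩
    rw [IsLarge, Function.update_self]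
    intro g hg
    obtain ⟨i, j, hij, h1, h2⟩ := hn _ _ _ (ht X C hC hXC hδC) (ht X C hC hXC hδC).inv g hg
    have key : ∀ h, δ' ≤ μ (C ∩ h • (C * T)) →
        G.IsLarge X T (Function.update N k n) k (C ∩ h • (C * T)) := fun h hh =>
      (hN _ (hC.inter ((hC.mul hT).smul h))
        ((Set.mul_subset_mul_left Set.inter_subset_left).trans hXC) hh).congr
        fun l hl => (Function.update_of_ne hl.ne _ _).symm
    exact ⟨i, j, hij, key _ h1, key _ h2⟩

/-- A large set that, up to `ε`, minimises `Φ` among its definable large subsets of the next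
lower rank. -/
theorem exists_almost_minimal {Φ : Set G → ℝ≥0∞} {ε : ℝ≥0∞} (hε : ε ≠ ⊤) (k : ℕ) {C : Set G}
    (hΦ : ∀ C' ⊆ C, G.IsDefinable C' → C'.Nonempty → Φ C' ≠ 0) (hC : G.IsDefinable C) (hk : G.IsLarge X T N k C)
    (hle : Φ C ≤ k * ε) :
    ∃ (l : ℕ) (C' : Set G), C' ⊆ C ∧ G.IsDefinable C' ∧ G.IsLarge X T N (l + 1) C' ∧
      ∀ C'' ⊆ C', G.IsDefinable C'' → G.IsLarge X T N l C'' → Φ C' ≤ Φ C'' + ε := by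
  induction k generalizing C with
  | zero =>
    simp only [Nat.cast_zero, zero_mul, nonpos_iff_eq_zero] at hle
    exact absurd hle (hΦ C subset_rfl hC hk)
  | succ k ih =>
    -- If this fails, pass to a counterexample: the rank drops by one and `Φ` by more than `ε`, so
    -- the bound `Φ ≤ rank * ε` persists. At rank `0` it would force `Φ = 0` on a nonempty set.
    by_cases h : ∀ C'' ⊆ C, G.IsDefinable C'' → G.IsLarge X T N k C'' → Φ C ≤ Φ C'' + ε
    · exact ⟨k, C, subset_rfl, hC, hk, h⟩
    · push Not at h
      obtain ⟨C₁, hC₁, hdef, hlarge, hlt⟩ := h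
      obtain ⟨l, C', hC', h⟩ := ih (fun C' hC' => hΦ C' (hC'.trans hC₁)) hdef hlarge (by
        have := hlt.le.trans hle
        push_cast at this
        rw [add_mul, one_mul] at this
        exact (ENNReal.add_le_add_iff_right hε).1 this)
      exact ⟨l, C', hC'.trans hC₁, h⟩

end Large

/-! ### Calculus of the error sets. -/

section ErrorSequence

variable {L : MSLanguage.{u, v}} {M : L.Sorts → Type w} [L.Structure M]
  {G : DefinableGroup L M} {A : Set G} {T : ℕ → Set G}

theorem IsErrorSequence.one_mem (hT : G.IsErrorSequence A T) (j : ℕ) : 1 ∈ T j :=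
  (hT.symmetric j).1

theorem IsErrorSequence.inv_mem (hT : G.IsErrorSequence A T) {j : ℕ} {x : G} (hx : x ∈ T j) :
    x⁻¹ ∈ T j := by
  rw [← (hT.symmetric j).2]
  exact Set.inv_mem_inv.2 hx

theorem IsErrorSequence.mul_mem (hT : G.IsErrorSequence A T) {j : ℕ} {x y : G}
    (hx : x ∈ T (j + 1)) (hy : y ∈ T (j + 1)) : x * y ∈ T j :=
  hT.sq_subset j (by rw [sq]; exact Set.mul_mem_mul hx hy)

theorem IsErrorSequence.antitone (hT : G.IsErrorSequence A T) : Antitone T :=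
  antitone_nat_of_succ_le fun j x hx => by
    simpa using hT.mul_mem hx (hT.one_mem (j + 1))

theorem IsErrorSequence.conj_mem (hT : G.IsErrorSequence A T) {n j : ℕ} {x y : G}
    (hx : x ∈ A ^ n) (hy : y ∈ T (j + n)) : x⁻¹ * y * x ∈ T j := by
  induction n generalizing j x y with
  | zero =>
    rw [pow_zero, Set.mem_one] at hx
    simpa [hx] using hy
  | succ n ih =>
    rw [pow_succ] at hx
    obtain ⟨x, hx, a, ha, rfl⟩ := hx
    have h := hT.conj_subset j a ha _ (ih (j := j + 1) hx (by rwa [add_right_comm]))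
    simpa [mul_assoc] using h

/-- Errors can be moved to the right of elements of `A ^ n`. -/
theorem IsErrorSequence.exists_mul_eq (hT : G.IsErrorSequence A T) {n j : ℕ} {x y : G}
    (hx : x ∈ A ^ n) (hy : y ∈ T (j + n)) : ∃ z ∈ T j, y * x = x * z :=
  ⟨_, hT.conj_mem hx hy, by simp [mul_assoc]⟩

/-- Each factor costs `n + 1` indices: `n` to move the accumulated error past an element of `A ^ n`,
and one to multiply it with the next error. -/
theorem IsErrorSequence.mul_pow_subset (hT : G.IsErrorSequence A T) {X : Set G} {n j : ℕ}
    (hX : X ⊆ A ^ n) (r : ℕ) : (X * T (j + (n + 1) * r)) ^ r ⊆ X ^ r * T j := by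
  induction r generalizing j with
  | zero => simpa using hT.one_mem j
  | succ r ih =>
    intro h hh
    rw [pow_succ] at hh
    obtain ⟨g, hgr, _, ⟨x, hx, y, hy, rfl⟩, rfl⟩ := hh
    have hg' : g ∈ X ^ r * T (j + (n + 1)) := by
      refine ih ?_
      rwa [show j + (n + 1) + (n + 1) * r = j + (n + 1) * (r + 1) by ring]
    obtain ⟨g, hg, z, hz, rfl⟩ := hg'
    obtain ⟨z', hz', hzx⟩ := hT.exists_mul_eq (j := j + 1) (hX hx)
      (by rwa [show j + 1 + n = j + (n + 1) by ring])
    have hy' : y ∈ T (j + 1) := hT.antitone (by nlinarith) hy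
    refine ⟨g * x, by rw [pow_succ]; exact Set.mul_mem_mul hg hx, z' * y, hT.mul_mem hz' hy', ?_⟩
    simp only [mul_assoc]
    rw [← mul_assoc z x, hzx, mul_assoc]

end ErrorSequence

/-! ### Almost stabilisers of a product set. -/

section Stabiliser

variable {L : MSLanguage.{u, v}} {M : L.Sorts → Type w} [L.Structure M]
  {G : DefinableGroup L M} {A : Set G} {T : ℕ → Set G}

/-- If `C ∩ a • (C * T j)` is almost as big as `C`, in the sense of the measure of products with
`D`, then `a • (C * D)` almost covers `C * D`. -/
theorem measure_sdiff_le (hT : G.IsErrorSequence A T) {μ : Set G → ℝ≥0∞} {p : ℕ}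
    (hμ : G.IsRoughMeasure (T p) μ) {C D Q : Set G} (hC : G.IsDefinable C) (hD : G.IsDefinable D)
    (hQ : G.IsDefinable Q) (hDA : D ⊆ A ^ 2) {j b : ℕ} (hj : b + 4 ≤ j) (hp : b + 2 ≤ p) {a : G}
    {ε : ℝ≥0∞} (hfin : μ (C * D * T (b + 2) ∩ Q) ≠ ⊤)
    (hle : μ (C * D * T (b + 2) ∩ Q) ≤
      μ ((C ∩ a • (C * T j)) * D * T (b + 2) ∩ Q) + ε) :
    μ (((C * D) \ (a • (C * D * T b))) * T (b + 2) ∩ Q) ≤ ε := by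
  have hTd := hT.definable
  set Y := (C ∩ a • (C * T j)) * D * T (b + 2) ∩ Q
  set Z := ((C * D) \ (a • (C * D * T b))) * T (b + 2) ∩ Q
  have hYd : G.IsDefinable Y :=
    (((hC.inter ((hC.mul (hTd j)).smul a)).mul hD).mul (hTd _)).inter hQ
  have hZd : G.IsDefinable Z :=
    ((((hC.mul hD).diff (((hC.mul hD).mul (hTd _)).smul a))).mul (hTd _)).inter hQ
  -- At a common point, moving `τ` past `d ∈ A ^ 2` costs two indices. Four errors in `T (b + 2)`
  -- then combine to one in `T b`, which puts `v` into the translate that was removed.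
  have hd : Y ∩ (Z * T p) = ∅ := by
    rw [Set.eq_empty_iff_forall_notMem]
    rintro y ⟨⟨⟨_, ⟨c, ⟨-, c', ⟨c₁, hc₁, τ, hτ, rfl⟩, rfl⟩, d, hd, rfl⟩, β, hβ, rfl⟩, -⟩,
      z, ⟨⟨v, ⟨-, hv⟩, β', hβ', rfl⟩, -⟩, σ, hσ, h⟩
    refine hv ?_
    obtain ⟨τ', hτ', hτd⟩ := hT.exists_mul_eq (j := b + 2) (hDA hd)
      (hT.antitone hj hτ)
    refine ⟨c₁ * d * ((τ' * β) * (σ⁻¹ * β'⁻¹)),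
      Set.mul_mem_mul (Set.mul_mem_mul hc₁ hd) (hT.mul_mem (hT.mul_mem hτ' hβ)
        (hT.mul_mem (hT.inv_mem (hT.antitone hp hσ)) (hT.inv_mem hβ'))), ?_⟩
    have h : v * β' * σ = a * (c₁ * τ) * d * β := h
    have h' : v = a * (c₁ * (τ * d)) * β * σ⁻¹ * β'⁻¹ := by
      rw [eq_mul_inv_iff_mul_eq, eq_mul_inv_iff_mul_eq, h]
      simp only [mul_assoc]
    rw [h', hτd]
    simp only [smul_eq_mul, mul_assoc]
  have hsub : Y ∪ Z ⊆ C * D * T (b + 2) ∩ Q :=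
    Set.union_subset
      (Set.inter_subset_inter_left _ (Set.mul_subset_mul_right
        (Set.mul_subset_mul_right Set.inter_subset_left)))
      (Set.inter_subset_inter_left _ (Set.mul_subset_mul_right Set.sdiff_subset))
  have hCd : G.IsDefinable (C * D * T (b + 2) ∩ Q) := ((hC.mul hD).mul (hTd _)).inter hQ
  have hY : μ Y ≠ ⊤ :=
    ne_top_of_le_ne_top hfin (hμ.mono _ _ hYd hCd (Set.subset_union_left.trans hsub))
  have h1 : μ Y + μ Z ≤ μ Y + ε := by
    rw [← hμ.additive _ _ hYd hZd hd]
    exact (hμ.mono _ _ (hYd.union hZd) hCd hsub).trans hle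
  exact (ENNReal.add_le_add_iff_left hY).1 h1

/-- Products of `l` elements of `S`, each of which almost stabilises `F`, still almost stabilise
`F`. -/
theorem measure_sdiff_pow_le (hT : G.IsErrorSequence A T) {μ : Set G → ℝ≥0∞} {p : ℕ}
    (hμ : G.IsRoughMeasure (T p) μ) (hμ0 : μ ∅ = 0)
    (hinv : ∀ (g : G) (Y : Set G), G.IsDefinable Y → μ (g • Y) = μ Y)
    {F S : Set G} (hF : G.IsDefinable F) {Q : ℕ → Set G} (hQ : ∀ l, G.IsDefinable (Q l))
    (hFQ : F ⊆ Q 0) (hSQ : ∀ l, ∀ a ∈ S, a⁻¹ • Q l ⊆ Q (l + 1))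
    (b : ℕ → ℕ) {s : ℕ} (hb : ∀ l < s, b l = b (l + 1) + 3) {ε : ℝ≥0∞}
    (hS : ∀ l < s, ∀ a ∈ S,
      μ ((F \ (a • (F * T (b (l + 1) + 1)))) * T (b (l + 1) + 3) ∩ Q l) ≤ ε) {l : ℕ} (hl : l ≤ s) :
    ∀ x ∈ S ^ l, x⁻¹ • F ⊆ Q l ∧ μ (F \ (x • (F * T (b l)))) ≤ l * ε := by
  have hTd := hT.definable
  induction l with
  | zero =>
    rintro x hx
    rw [pow_zero, Set.mem_one] at hx
    subst hx
    have h : F ⊆ F * T (b 0) := fun f hf => ⟨f, hf, 1, hT.one_mem _, mul_one f⟩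
    simp [Set.sdiff_eq_empty.2 h, hμ0, hFQ]
  | succ l ih =>
    intro x hx
    rw [pow_succ] at hx
    obtain ⟨x, hx, a, ha, rfl⟩ := hx
    obtain ⟨hxQ, hxμ⟩ := ih (by omega) x hx
    constructor
    · refine subset_trans ?_ (hSQ l a ha)
      simp only [mul_inv_rev, mul_smul]
      exact Set.smul_set_mono hxQ
    · set Z := (F \ (a • (F * T (b (l + 1) + 1)))) * T (b (l + 1) + 3) ∩ Q l
      have hZ : G.IsDefinable Z :=
        ((hF.diff ((hF.mul (hTd _)).smul a)).mul (hTd _)).inter (hQ l)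
      have hV : G.IsDefinable (F \ (x • (F * T (b l)))) := hF.diff ((hF.mul (hTd _)).smul x)
      have hsub : F \ ((x * a) • (F * T (b (l + 1)))) ⊆ F \ (x • (F * T (b l))) ∪ x • Z := by
        rintro f ⟨hf, hfx⟩
        -- Here `x⁻¹ * f` lies in `F` only up to an error `τ`, which is why the defect `Z` is
        -- fattened. If its `F`-part were in `a • (F * T (b (l + 1) + 1))`, absorbing `τ` would put
        -- `f` into the set removed for `x * a`.
        by_cases h : f ∈ x • (F * T (b l))
        · right
          obtain ⟨_, ⟨y, hy, τ, hτ, rfl⟩, rfl⟩ := h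
          rw [hb l hl] at hτ
          refine ⟨y * τ, ⟨⟨y, ⟨hy, ?_⟩, τ, hτ, rfl⟩, hxQ ⟨_, hf, by simp⟩⟩, rfl⟩
          rintro ⟨_, ⟨y', hy', τ', hτ', rfl⟩, rfl⟩
          refine hfx ⟨y' * (τ' * τ), Set.mul_mem_mul hy'
            (hT.mul_mem hτ' (hT.antitone (by omega) hτ)), ?_⟩
          simp [mul_assoc]
        · exact .inl ⟨hf, h⟩
      calc μ (F \ ((x * a) • (F * T (b (l + 1))))) ≤ μ (F \ (x • (F * T (b l))) ∪ x • Z) :=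
            hμ.mono _ _ (hF.diff ((hF.mul (hTd _)).smul _)) (hV.union (hZ.smul x)) hsub
        _ ≤ μ (F \ (x • (F * T (b l)))) + μ (x • Z) := hμ.subadditive _ _ hV (hZ.smul x)
        _ ≤ l * ε + ε := add_le_add hxμ (by rw [hinv x Z hZ]; exact hS l hl a ha)
        _ = ((l + 1 : ℕ) : ℝ≥0∞) * ε := by push_cast; ring

end Stabiliser

/-! ### The stabiliser argument for one definable set. -/

section Core

variable {L : MSLanguage.{u, v}} {M : L.Sorts → Type w} [L.Structure M]
  {G : DefinableGroup L M} {A : Set G} {T : ℕ → Set G} {μ : ℕ → Set G → ℝ≥0∞}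

/-- Finitely many translates `e • D` with `e ∈ A` cover `A`, so their traces on `A` cannot all be
null. -/
theorem exists_measure_inter_ne_zero {ν : Set G → ℝ≥0∞} {T : Set G} (hν : G.IsRoughMeasure T ν)
    (hA : G.IsDefinable A) (hA0 : ν A ≠ 0) (hAtop : ν A ≠ ⊤) {D : Set G} (hD : G.IsDefinable D)
    {t : ℕ} (ht : G.IsThickWith t D A) : ∃ e ∈ A, ν (A ∩ e • D) ≠ 0 := by
  obtain ⟨k, g, hg, hcov⟩ := ht.exists_cover
  by_contra! hcon
  refine hA0 (le_zero_iff.1 ?_)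
  have hdef : ∀ i, G.IsDefinable (A ∩ g i • D) := fun i => hA.inter (hD.smul _)
  calc ν A ≤ ν (∅ ∪ ⋃ i, A ∩ g i • D) :=
        hν.mono _ _ hA (isDefinable_empty.union (.iUnion hdef)) (by
          rw [Set.empty_union, ← Set.inter_iUnion]
          exact Set.subset_inter subset_rfl hcov)
    _ ≤ ν ∅ + ∑ i, ν (A ∩ g i • D) := hν.measure_union_iUnion_le isDefinable_empty hdef
    _ = 0 := by
      rw [hν.measure_empty hA hAtop, zero_add]
      exact Finset.sum_eq_zero fun i _ => hcon _ (hg i)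

/-- A point `c = h * c' * τ` of the first overlap shows that `h` is `c * c'⁻¹` up to an error.
Replacing `h` by this exact quotient only costs indices, and quotients from `C` interact well with
the windows used later. -/
theorem IsErrorSequence.exists_large_error (hT : G.IsErrorSequence A T) {C X : Set G}
    (hCA : C ⊆ A ^ 2) (hC'A : C⁻¹ ⊆ A ^ 2) {N : ℕ → ℕ} {k q : ℕ} (hX : X.Nonempty) {h : G}
    (h₁ : G.IsLarge X (T (q + 9)) N k (C ∩ h • (C * T (q + 9))))
    (h₂ : G.IsLarge X (T (q + 9)) N k (C ∩ h⁻¹ • (C * T (q + 9)))) :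
    ∃ a ∈ C * C⁻¹, ∃ z ∈ T (q + 7), h = a * z ∧
      G.IsLarge X (T (q + 9)) N k (C ∩ a • (C * T q)) ∧
      G.IsLarge X (T (q + 9)) N k (C ∩ a⁻¹ • (C * T q)) := by
  obtain ⟨c, hc, _, ⟨c', hc', τ, hτ, rfl⟩, hcc⟩ := h₁.nonempty hX
  have hcc : h * (c' * τ) = c := hcc
  obtain ⟨z, hz, hzc⟩ := hT.exists_mul_eq (j := q + 7) (hC'A (Set.inv_mem_inv.2 hc'))
    (hT.inv_mem hτ)
  have hmem : c * c'⁻¹ ∈ C * C⁻¹ := Set.mul_mem_mul hc (Set.inv_mem_inv.2 hc')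
  have hh : h = c * c'⁻¹ * z := by
    rw [mul_assoc, ← hzc, ← hcc]
    simp [mul_assoc]
  have hCT : ∀ {j : ℕ} {y x : G}, y ∈ T (j + 3) → x ∈ C * T (j + 1) → y * x ∈ C * T j := by
    rintro j y _ hy ⟨x, hx, σ, hσ, rfl⟩
    obtain ⟨y', hy', hyx⟩ := hT.exists_mul_eq (j := j + 1) (hCA hx) hy
    refine ⟨x, hx, y' * σ, hT.mul_mem hy' hσ, ?_⟩
    change x * (y' * σ) = y * (x * σ)
    rw [← mul_assoc, ← mul_assoc, hyx]
  have hA4 : c' * c⁻¹ ∈ A ^ 4 := by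
    rw [show 4 = 2 + 2 from rfl, pow_add]
    exact Set.mul_mem_mul (hCA hc') (hC'A (Set.inv_mem_inv.2 hc))
  obtain ⟨z', hz', hzc'⟩ := hT.exists_mul_eq (j := q + 3) hA4 (hT.inv_mem hz)
  refine ⟨_, hmem, z, hz, hh, h₁.mono (Set.inter_subset_inter_right _ ?_),
    h₂.mono (Set.inter_subset_inter_right _ ?_)⟩
  · rw [hh, mul_smul]
    refine Set.smul_set_mono ?_
    rintro _ ⟨x, hx, rfl⟩
    exact hCT (hT.antitone (by omega) hz)
      (Set.mul_subset_mul_left (hT.antitone (by omega)) hx)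
  · have : h⁻¹ = (c * c'⁻¹)⁻¹ * z' := by
      rw [hh]
      simpa using hzc'
    rw [this, mul_smul]
    refine Set.smul_set_mono ?_
    rintro _ ⟨x, hx, rfl⟩
    exact hCT hz' (Set.mul_subset_mul_left (hT.antitone (by omega)) hx)

theorem IsSymmetric.inv_pow (hA : G.IsSymmetric A) (n : ℕ) : (A ^ n)⁻¹ = A ^ n := by
  rw [← _root_.inv_pow, hA.2]

theorem IsSymmetric.pow_subset_pow (hA : G.IsSymmetric A) {k n : ℕ} (h : k ≤ n) :
    A ^ k ⊆ A ^ n :=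
  Set.pow_subset_pow_right hA.1 h

theorem exists_definable_thick (hA : G.IsDefinable A) (hA_symm : G.IsSymmetric A)
    (hT : G.IsErrorSequence A T) (hμ : G.IsRoughAmenable A T μ) {m r s n : ℕ} (i : ℕ)
    (hmn : m + 2 ≤ n) (hs : 1 ≤ s) (hrs : r ≤ 2 * s) (hsn : 2 * s + 1 ≤ n)
    (hfin : ∀ j, μ j (A ^ n) ≠ ⊤) {D : Set G} (hD : G.IsDefinable D) (hD_inv : D⁻¹ = D)
    (hDA : D ⊆ A ^ 2) {t : ℕ} (ht : G.IsThickWith t D A) :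
    ∃ S : Set G, G.IsDefinable S ∧ S ⊆ A ^ (2 * m) ∧ (∃ t, G.IsThickWith t S (A ^ m)) ∧
      S ⊆ D ^ 2 * T i ∧ S ^ r ⊆ D ^ 4 * T i := by
  have hTd := hT.definable
  -- The error index after `l` steps of the stabiliser iteration: three are lost per step, ending at
  -- `i + 6`.
  set b : ℕ → ℕ := fun l => i + 6 + 3 * (s - l) with hb
  -- Room for the `3 * s` losses of that iteration and the `5 * r` losses in passing from `S ^ r` to
  -- `R ^ r` with `R ⊆ A ^ 4`, plus slack.
  set q : ℕ := i + 3 * s + 5 * r + 20 with hq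
  set ν := μ (q + 9) with hν_def
  have hν : G.IsRoughMeasure (T (q + 9)) ν := hμ.rough _
  have hinv : ∀ (g : G) (Y : Set G), G.IsDefinable Y → ν (g • Y) = ν Y := hμ.invariant _
  have hνfin : ∀ {j : ℕ}, j ≤ n → ν (A ^ j) ≠ ⊤ := fun hj =>
    ne_top_of_le_ne_top (hfin _) (hν.mono _ _ (hA.pow _) (hA.pow _) (hA_symm.pow_subset_pow hj))
  have hν0 : ν ∅ = 0 := hν.measure_empty (hA.pow n) (hfin _)
  have hX : (A ^ m).Nonempty := ⟨1, Set.one_mem_pow hA_symm.1⟩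
  have hinvA : ∀ {x : G}, x ∈ A → x⁻¹ ∈ A := fun hx => by
    rw [← hA_symm.2]
    exact Set.inv_mem_inv.2 hx
  -- a translate of a big piece of `D`
  obtain ⟨e, he, heD⟩ := exists_measure_inter_ne_zero hν hA
    (by rw [hν_def, hμ.normalised]; exact one_ne_zero)
    (by rw [hν_def, hμ.normalised]; exact ENNReal.one_ne_top) hD ht
  set C₀ : Set G := e⁻¹ • (A ∩ e • D) with hC₀_def
  have hC₀ : G.IsDefinable C₀ := (hA.inter (hD.smul e)).smul _
  have hC₀D : C₀ ⊆ D := by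
    rw [hC₀_def, Set.smul_set_inter, inv_smul_smul]
    exact Set.inter_subset_right
  have hC₀A : ∀ c ∈ C₀, e * c ∈ A := by
    rintro _ ⟨x, hx, rfl⟩
    simpa using hx.1
  set δ := ν C₀ with hδ_def
  have hδ : δ ≠ 0 := by rwa [hδ_def, hinv _ _ (hA.inter (hD.smul e))]
  have hδD : δ ≤ ν D := hν.mono _ _ hC₀ hD hC₀D
  have hδfin : δ ≠ ⊤ := ne_top_of_le_ne_top (hνfin (j := 2) (by omega))
    (hν.mono _ _ hC₀ (hA.pow 2) (hC₀D.trans hDA))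
  -- Chosen so that two defects of measure at most `s * ε` cannot cover a set of measure at least
  -- `δ`.
  set ε := δ / (2 * s + 1 : ℕ) with hε_def
  have hε0 : ε ≠ 0 := ENNReal.div_ne_zero.2 ⟨hδ, ENNReal.natCast_ne_top _⟩
  have hεfin : ε ≠ ⊤ := ENNReal.div_ne_top hδfin (by positivity)
  have hεδ : (2 * s : ℕ) * ε < δ := by
    have h : ((2 * s + 1 : ℕ) : ℝ≥0∞) * ε = δ :=
      ENNReal.mul_div_cancel (by positivity) (ENNReal.natCast_ne_top _)
    rw [← h]
    exact (ENNReal.mul_lt_mul_iff_left hε0 hεfin).2 (by exact_mod_cast Nat.lt_succ_self _)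
  -- the functional to be minimised
  set Q : ℕ → Set G := fun l => e⁻¹ • A ^ (3 + 2 * l) with hQ_def
  have hQ : ∀ l, G.IsDefinable (Q l) := fun l => (hA.pow _).smul _
  set φ : ℕ → Set G → ℝ≥0∞ := fun l C => ν (C * D * T (b (l + 1) + 3) ∩ Q l) with hφ_def
  have hφd : ∀ l C, G.IsDefinable C → G.IsDefinable (C * D * T (b (l + 1) + 3) ∩ Q l) :=
    fun l C hC => ((hC.mul hD).mul (hTd _)).inter (hQ l)
  have hφfin : ∀ l < s, ∀ C, G.IsDefinable C → φ l C ≠ ⊤ := fun l hl C hC => by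
    refine ne_top_of_le_ne_top (hνfin (j := 3 + 2 * l) (by omega)) ?_
    rw [← hinv e⁻¹ _ (hA.pow _)]
    exact hν.mono _ _ (hφd l C hC) (hQ l) Set.inter_subset_right
  have hφmono : ∀ l C C', G.IsDefinable C → G.IsDefinable C' → C ⊆ C' → φ l C ≤ φ l C' :=
    fun l C C' hC hC' h => hν.mono _ _ (hφd l C hC) (hφd l C' hC')
      (Set.inter_subset_inter_left _ (Set.mul_subset_mul_right (Set.mul_subset_mul_right h)))
  set Φ : Set G → ℝ≥0∞ := fun C => ∑ l ∈ Finset.range s, φ l C with hΦ_def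
  have hFQ : ∀ C ⊆ C₀, C * D ⊆ Q 0 := by
    rintro C hC _ ⟨c, hc, d, hd, rfl⟩
    refine ⟨e * c * d, ?_, by simp [mul_assoc]⟩
    rw [show 3 + 2 * 0 = 1 + 2 from rfl, pow_add, pow_one]
    exact Set.mul_mem_mul (hC₀A c (hC hc)) (hDA hd)
  have hδF : ∀ C ⊆ C₀, G.IsDefinable C → C.Nonempty → δ ≤ ν (C * D) := by
    rintro C hC hCd ⟨c, hc⟩
    refine hδD.trans ?_
    rw [← hinv c D hD]
    exact hν.mono _ _ (hD.smul c) (hCd.mul hD) (Set.smul_set_subset_mul hc)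
  have hΦ : ∀ C ⊆ C₀, G.IsDefinable C → C.Nonempty → Φ C ≠ 0 := by
    intro C hC hCd hne h0
    have h : φ 0 C = 0 := Finset.sum_eq_zero_iff.1 h0 0 (Finset.mem_range.2 hs)
    refine hδ (le_zero_iff.1 ((hδF C hC hCd hne).trans (h ▸ ?_)))
    refine hν.mono _ _ (hCd.mul hD) (hφd 0 C hCd) (Set.subset_inter ?_ (hFQ C hC))
    exact fun f hf => ⟨f, hf, 1, hT.one_mem _, mul_one f⟩
  obtain ⟨k₀, hk₀⟩ := ENNReal.exists_nat_mul_gt hε0 (ENNReal.sum_ne_top.2 fun l hl =>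
    hφfin l (Finset.mem_range.1 hl) C₀ hC₀ : Φ C₀ ≠ ⊤)
  obtain ⟨N, hN⟩ := hν.exists_isLarge hinv (hTd _) (X := A ^ m) (hA.pow n) (hfin _) k₀ hδ
  have hXC₀ : A ^ m * C₀ ⊆ A ^ n := by
    refine subset_trans ?_ (hA_symm.pow_subset_pow hmn)
    rw [pow_add]
    exact Set.mul_subset_mul_left (hC₀D.trans hDA)
  obtain ⟨k, C, hCC₀, hC, hCl, hmin⟩ :=
    exists_almost_minimal hεfin k₀ hΦ hC₀ (hN C₀ hC₀ hXC₀ le_rfl) hk₀.le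
  have hCne : C.Nonempty := hCl.nonempty hX
  have hCD : C ⊆ D := hCC₀.trans hC₀D
  have hCinvD : C⁻¹ ⊆ D := by
    rw [← hD_inv]
    exact Set.inv_subset_inv.2 hCD
  have hCCA : C * C⁻¹ ⊆ A ^ 4 := by
    rw [show 4 = 2 + 2 from rfl, pow_add]
    exact Set.mul_subset_mul (hCD.trans hDA) (hCinvD.trans hDA)
  set F := C * D with hF_def
  have hF : G.IsDefinable F := hC.mul hD
  set S : Set G := {h | h ∈ A ^ (2 * m) ∧
    G.IsLarge (A ^ m) (T (q + 9)) N k (C ∩ h • (C * T (q + 9))) ∧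
    G.IsLarge (A ^ m) (T (q + 9)) N k (C ∩ h⁻¹ • (C * T (q + 9)))} with hS_def
  set R : Set G := {a | a ∈ C * C⁻¹ ∧
    G.IsLarge (A ^ m) (T (q + 9)) N k (C ∩ a • (C * T q)) ∧
    G.IsLarge (A ^ m) (T (q + 9)) N k (C ∩ a⁻¹ • (C * T q))} with hR_def
  have hRA : R ⊆ A ^ 4 := fun a ha => hCCA ha.1
  have hSR : S ⊆ R * T (q + 7) := by
    rintro h ⟨-, h₁, h₂⟩
    obtain ⟨a, ha, z, hz, rfl, ha₁, ha₂⟩ :=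
      hT.exists_large_error (hCD.trans hDA) (hCinvD.trans hDA) hX h₁ h₂
    exact Set.mul_mem_mul ⟨ha, ha₁, ha₂⟩ hz
  have hR1 : (1 : G) ∈ R := by
    have h : G.IsLarge (A ^ m) (T (q + 9)) N k (C ∩ (1 : G) • (C * T q)) := by
      refine (hCl.of_succ hX).mono (Set.subset_inter subset_rfl ?_)
      rw [one_smul]
      exact fun c hc => ⟨c, hc, 1, hT.one_mem _, mul_one c⟩
    obtain ⟨c, hc⟩ := hCne
    exact ⟨⟨c, hc, c⁻¹, Set.inv_mem_inv.2 hc, mul_inv_cancel c⟩, h, by rwa [inv_one]⟩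
  have hRinv : R⁻¹ = R := by
    have h : ∀ a ∈ R, a⁻¹ ∈ R := fun a ha =>
      ⟨by simpa using Set.inv_mem_inv.2 ha.1, ha.2.2, by rw [inv_inv]; exact ha.2.1⟩
    exact Set.Subset.antisymm (fun a ha => inv_inv a ▸ h _ ha) fun a ha => h a ha
  have hRQ : ∀ l, ∀ a ∈ R, a⁻¹ • Q l ⊆ Q (l + 1) := by
    rintro l _ ⟨⟨c, hc, c', hc', rfl⟩, -⟩ _ ⟨_, ⟨x, hx, rfl⟩, rfl⟩
    refine ⟨(e * c'⁻¹) * (e * c)⁻¹ * x, ?_, by simp [mul_assoc]⟩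
    rw [show 3 + 2 * (l + 1) = 1 + 1 + (3 + 2 * l) by ring, pow_add, pow_add, pow_one]
    exact Set.mul_mem_mul (Set.mul_mem_mul (hC₀A _ (hCC₀ hc')) (hinvA (hC₀A _ (hCC₀ hc)))) hx
  have hRμ : ∀ l < s, ∀ a ∈ R,
      ν ((F \ (a • (F * T (b (l + 1) + 1)))) * T (b (l + 1) + 3) ∩ Q l) ≤ ε := by
    rintro l hl a ⟨-, ha, -⟩
    have hC' : G.IsDefinable (C ∩ a • (C * T q)) := hC.inter ((hC.mul (hTd _)).smul _)
    refine measure_sdiff_le hT hν hC hD (hQ l) hDA (j := q) (by simp only [hb, hq]; omega)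
      (by simp only [hb, hq]; omega) (hφfin l hl C hC) ?_
    have h := hmin _ Set.inter_subset_left hC' ha
    simp only [hΦ_def] at h
    -- Almost minimality of the sum passes to each summand, because the other summands cannot
    -- increase when `C` shrinks.
    rw [← Finset.add_sum_erase _ _ (Finset.mem_range.2 hl),
      ← Finset.add_sum_erase _ _ (Finset.mem_range.2 hl)] at h
    have h' : ∑ x ∈ (Finset.range s).erase l, φ x (C ∩ a • (C * T q)) ≤
        ∑ x ∈ (Finset.range s).erase l, φ x C :=
      Finset.sum_le_sum fun x _ => hφmono x _ _ hC' hC Set.inter_subset_left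
    have h'' : ∑ x ∈ (Finset.range s).erase l, φ x C ≠ ⊤ :=
      ENNReal.sum_ne_top.2 fun x hx =>
        hφfin x (Finset.mem_range.1 (Finset.mem_of_mem_erase hx)) C hC
    refine (ENNReal.add_le_add_iff_right h'').1 (h.trans ?_)
    rw [add_right_comm]
    exact add_le_add_right h' _
  have hRs : ∀ x ∈ R ^ s, ν (F \ (x • (F * T (i + 6)))) ≤ s * ε := fun x hx => by
    have := (measure_sdiff_pow_le hT hν hν0 hinv hF hQ (hFQ C hCC₀) hRQ b
      (fun l hl => by simp only [hb]; omega) hRμ le_rfl x hx).2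
    simpa [hb] using this
  have hR4 : R ^ (2 * s) ⊆ F * T (i + 5) * F⁻¹ := by
    intro w hw
    rw [two_mul, pow_add] at hw
    obtain ⟨x, hx, y, hy, rfl⟩ := hw
    have hx' : x⁻¹ ∈ R ^ s := by
      rw [← hRinv, inv_pow]
      exact Set.inv_mem_inv.2 hx
    have hd : ∀ g : G, G.IsDefinable (F \ (g • (F * T (i + 6)))) := fun g =>
      hF.diff ((hF.mul (hTd _)).smul g)
    obtain ⟨f, ⟨f₁, ⟨u₁, hu₁, τ₁, hτ₁, rfl⟩, h₁⟩, ⟨f₂, ⟨u₂, hu₂, τ₂, hτ₂, rfl⟩, h₂⟩⟩ :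
        ∃ f, f ∈ x⁻¹ • (F * T (i + 6)) ∧ f ∈ y • (F * T (i + 6)) := by
      -- Otherwise the defects of `x⁻¹` and `y` cover `F`, giving `δ ≤ ν F ≤ 2 * s * ε < δ`.
      by_contra! hcon
      refine absurd ((hδF C hCC₀ hC hCne).trans ((hν.mono _ _ hF ((hd x⁻¹).union (hd y))
        fun f hf => ?_).trans ((hν.subadditive _ _ (hd _) (hd _)).trans
          (add_le_add (hRs _ hx') (hRs _ hy))))) (not_le.2 ?_)
      · by_cases h : f ∈ x⁻¹ • (F * T (i + 6))
        · exact .inr ⟨hf, hcon f h⟩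
        · exact .inl ⟨hf, h⟩
      · rw [← add_mul, ← two_mul]
        exact_mod_cast hεδ
    have h₁ : x⁻¹ * (u₁ * τ₁) = f := h₁
    have h₂ : y * (u₂ * τ₂) = f := h₂
    refine ⟨u₁ * (τ₁ * τ₂⁻¹), Set.mul_mem_mul hu₁ (hT.mul_mem hτ₁ (hT.inv_mem hτ₂)), u₂⁻¹,
      Set.inv_mem_inv.2 hu₂, ?_⟩
    have hx1 : x = u₁ * τ₁ * f⁻¹ := by rw [← h₁]; group
    have hy1 : y = f * (u₂ * τ₂)⁻¹ := by rw [← h₂]; group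
    change u₁ * (τ₁ * τ₂⁻¹) * u₂⁻¹ = x * y
    rw [hx1, hy1]
    group
  refine ⟨S, ?_, fun h hh => hh.1, ⟨N k, ?_⟩, ?_, ?_⟩
  · have hfam : G.DefinableFamily fun _ : Unit → G => C := .const hC
    have hfam' : G.DefinableFamily fun _ : Unit → G => C * T (q + 9) :=
      .const (hC.mul (hTd _))
    exact definablePred_mem_iff.1 ((DefinablePred.mem (hA.pow _) (definableFun_proj ())).and
      ((DefinablePred.isLarge (hA.pow m) (hTd _) k
        (hfam.inter (hfam'.smul (definableFun_proj ())))).and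
      (DefinablePred.isLarge (hA.pow m) (hTd _) k
        (hfam.inter (hfam'.smul (definableFun_proj ()).inv)))))
  · intro g hg
    -- Thickness of `S` is exactly largeness of `C` at rank `k + 1`.
    obtain ⟨x, y, hxy, h₁, h₂⟩ := hCl g hg
    refine ⟨x, y, hxy, ?_, h₁, h₂⟩
    rw [two_mul, pow_add]
    refine Set.mul_mem_mul ?_ (hg y)
    rw [← hA_symm.inv_pow]
    exact Set.inv_mem_inv.2 (hg x)
  · refine hSR.trans (Set.mul_subset_mul ?_ (hT.antitone (by omega)))
    rw [sq]
    exact fun a ha => Set.mul_subset_mul hCD hCinvD ha.1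
  · have hFA : F⁻¹ ⊆ A ^ 4 := by
      rw [hF_def, mul_inv_rev, hD_inv, show 4 = 2 + 2 from rfl, pow_add]
      exact Set.mul_subset_mul hDA (hCinvD.trans hDA)
    have h1 : S ^ r ⊆ R ^ (2 * s) * T (i + 1) :=
      calc S ^ r ⊆ (R * T (i + 1 + (4 + 1) * r)) ^ r :=
            Set.pow_subset_pow_left (hSR.trans
              (Set.mul_subset_mul_left (hT.antitone (by omega))))
        _ ⊆ R ^ r * T (i + 1) := hT.mul_pow_subset hRA r
        _ ⊆ R ^ (2 * s) * T (i + 1) :=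
            Set.mul_subset_mul_right (Set.pow_subset_pow_right hR1 hrs)
    intro w hw
    obtain ⟨v, hv, z, hz, rfl⟩ := h1 hw
    obtain ⟨_, ⟨f, hf, τ, hτ, rfl⟩, f', hf', rfl⟩ := hR4 hv
    obtain ⟨τ', hτ', h⟩ := hT.exists_mul_eq (j := i + 1) (hFA hf') hτ
    refine ⟨f * f', ?_, τ' * z, hT.mul_mem hτ' hz, ?_⟩
    · rw [show 4 = 2 + 2 from rfl, pow_add, sq]
      refine Set.mul_mem_mul (Set.mul_subset_mul_right hCD hf) ?_
      have : F⁻¹ ⊆ D * D := by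
        rw [hF_def, mul_inv_rev, hD_inv]
        exact Set.mul_subset_mul_left hCinvD
      exact this hf'
    · change f * f' * (τ' * z) = f * τ * f' * z
      rw [mul_assoc f τ, h]
      simp only [mul_assoc]

end Core

/-! ### Passage to type-definable sets. -/

section Assembly

variable {L : MSLanguage.{u, v}} {M : L.Sorts → Type w} [L.Structure M]
  {G : DefinableGroup L M} {A : Set G} {T : ℕ → Set G} {μ : ℕ → Set G → ℝ≥0∞}

theorem IsThick.one_mem_sInter {F : Set (Set G)} (hF : ∀ Z ∈ F, G.IsDefinable Z)
    (h : G.IsThick (⋂₀ F) A) (hA : A.Nonempty) : 1 ∈ ⋂₀ F := fun Z hZ =>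
  let ⟨_, ht⟩ := h Z (hF Z hZ) (Set.sInter_subset_of_mem hZ)
  ht.one_mem hA

/-- `D` may be replaced by `D ∩ D⁻¹ ∩ A ^ 2`: inverses are handled by Ramsey's theorem, and
quotients of elements of `A` lie in `A ^ 2` anyway. -/
theorem exists_definable_thick_of_isThick (hA : G.IsDefinable A) (hA_symm : G.IsSymmetric A)
    (hT : G.IsErrorSequence A T) (hμ : G.IsRoughAmenable A T μ) {m r s n : ℕ} (i : ℕ)
    (hmn : m + 2 ≤ n) (hs : 1 ≤ s) (hrs : r ≤ 2 * s) (hsn : 2 * s + 1 ≤ n)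
    (hfin : ∀ j, μ j (A ^ n) ≠ ⊤) {D : Set G} (hD : G.IsDefinable D)
    {t : ℕ} (ht : G.IsThickWith t D A) :
    ∃ S : Set G, G.IsDefinable S ∧ S ⊆ A ^ (2 * m) ∧ (∃ t, G.IsThickWith t S (A ^ m)) ∧
      S ⊆ D ^ 2 * T i ∧ S ^ r ⊆ D ^ 4 * T i := by
  obtain ⟨t', ht'⟩ := ht.inter ht.inv
  have ht'' : G.IsThickWith t' (D ∩ D⁻¹ ∩ A ^ 2) A := by
    intro g hg
    obtain ⟨j, k, hjk, h⟩ := ht' g hg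
    refine ⟨j, k, hjk, h, ?_⟩
    rw [sq]
    refine Set.mul_mem_mul ?_ (hg k)
    rw [← hA_symm.2]
    exact Set.inv_mem_inv.2 (hg j)
  have hD' : D ∩ D⁻¹ ∩ A ^ 2 ⊆ D := Set.inter_subset_left.trans Set.inter_subset_left
  obtain ⟨S, hS, hSA, hSt, hS2, hS4⟩ := exists_definable_thick hA hA_symm hT hμ i hmn hs hrs hsn
    hfin ((hD.inter hD.inv).inter (hA.pow 2)) (by
      rw [Set.inter_inv, Set.inter_inv, inv_inv, hA_symm.inv_pow, Set.inter_comm D⁻¹])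
    Set.inter_subset_right ht''
  exact ⟨S, hS, hSA, hSt, hS2.trans (Set.mul_subset_mul_right (Set.pow_subset_pow_left hD')),
    hS4.trans (Set.mul_subset_mul_right (Set.pow_subset_pow_left hD'))⟩

theorem exists_isTypeDefinable_isThick {κ : Cardinal.{w}} (hκ : ℵ₀ < κ)
    (hM : IsSaturated L M κ) (hA : G.IsDefinable A) (hA_symm : G.IsSymmetric A)
    (hT : G.IsErrorSequence A T) (hμ : G.IsRoughAmenable A T μ) {m r s n : ℕ}
    (hmn : m + 2 ≤ n) (hs : 1 ≤ s) (hrs : r ≤ 2 * s) (hsn : 2 * s + 1 ≤ n)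
    (hfin : ∀ j, μ j (A ^ n) ≠ ⊤) {B : Set G} (hB : G.IsTypeDefinable κ B)
    (hB_thick : G.IsThick B A) :
    ∃ S : Set G, G.IsTypeDefinable κ S ∧ S ⊆ A ^ (2 * m) ∧ S ⊆ B ^ 2 * ⋂ i, T i ∧
      (G.IsThick B (A ^ m) → S ⊆ B) ∧ G.IsThick S (A ^ m) ∧ S ^ r ⊆ B ^ 4 * ⋂ i, T i := by
  classical
  obtain ⟨F, hFκ, hF, rfl⟩ := hB
  let D : Finset F × ℕ → Set G := fun j => ⋂ Y ∈ j.1, (Y : Set G)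
  have hJ : #(Finset F × ℕ) < κ := by
    rw [Cardinal.mk_prod, Cardinal.lift_uzero, Cardinal.mk_nat, Cardinal.lift_aleph0]
    refine Cardinal.mul_lt_of_lt hκ.le ?_ hκ
    cases finite_or_infinite F
    · exact (Cardinal.mk_lt_aleph0).trans hκ
    · rwa [Cardinal.mk_finset_of_infinite]
  have hD : ∀ j, G.IsDefinable (D j) := fun j => by
    have := IsDefinable.iInter (G := G) (J := j.1) (X := fun Y => Y.1.1) fun Y => hF _ Y.1.2
    rwa [Set.iInter_subtype] at this
  have hBD : ∀ j, ⋂₀ F ⊆ D j := fun j =>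
    Set.subset_iInter₂ fun Y _ => Set.sInter_subset_of_mem Y.2
  have hDB : ⋂ j, D j ⊆ ⋂₀ F := fun x hx Z hZ => by
    exact Set.mem_iInter₂.1 (Set.mem_iInter.1 hx ({⟨Z, hZ⟩}, 0)) ⟨Z, hZ⟩
      (Finset.mem_singleton_self _)
  have hDanti : Antitone D := fun j k hjk => Set.biInter_subset_biInter_left hjk.1
  have hTanti : Antitone fun j : Finset F × ℕ => T j.2 := fun j k hjk => hT.antitone hjk.2
  have hTj : ⋂ j : Finset F × ℕ, T j.2 ⊆ ⋂ i, T i :=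
    Set.subset_iInter fun i => Set.iInter_subset (fun j : Finset F × ℕ => T j.2) (∅, i)
  have hpow_anti : ∀ k : ℕ, Antitone fun j => D j ^ k := fun k i j hij =>
    Set.pow_subset_pow_left (hDanti hij)
  have hpow : ∀ k : ℕ, ⋂ j, D j ^ k ⊆ (⋂₀ F) ^ k := by
    intro k
    induction k with
    | zero => simpa using Set.iInter_subset (fun _ : Finset F × ℕ => (1 : Set G)) (∅, 0)
    | succ k ih =>
      simp only [pow_succ]
      exact (iInter_mul_subset hκ hM hJ (fun j => (hD j).pow k) hD (hpow_anti k) hDanti).trans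
        (Set.mul_subset_mul ih hDB)
  have hpowT : ∀ k : ℕ, ⋂ j, D j ^ k * T j.2 ⊆ (⋂₀ F) ^ k * ⋂ i, T i := fun k =>
    (iInter_mul_subset hκ hM hJ (fun j => (hD j).pow k) (fun j => hT.definable j.2)
      (hpow_anti k) hTanti).trans (Set.mul_subset_mul (hpow k) hTj)
  have hex : ∀ j : Finset F × ℕ, ∃ S : Set G, G.IsDefinable S ∧ S ⊆ A ^ (2 * m) ∧
      (∃ t, G.IsThickWith t S (A ^ m)) ∧ S ⊆ D j ^ 2 * T j.2 ∧ S ^ r ⊆ D j ^ 4 * T j.2 :=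
    fun j => by
      obtain ⟨t, ht⟩ := hB_thick _ (hD j) (hBD j)
      exact exists_definable_thick_of_isThick hA hA_symm hT hμ j.2 hmn hs hrs hsn hfin (hD j) ht
  choose S hSd hSA hSt hS2 hS4 using hex
  -- Either all of `F` or empty: the sets defining `B` are added precisely when they are thick in `A
  -- ^ m`, and this forces `S ⊆ B`.
  set F' : Set (Set G) := {Z | Z ∈ F ∧ G.IsThick (⋂₀ F) (A ^ m)}
  have hdef : ∀ Z ∈ Set.range S ∪ F', G.IsDefinable Z := by
    rintro Z (⟨j, rfl⟩ | hZ)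
    · exact hSd j
    · exact hF Z hZ.1
  have hcard : #(Set.range S ∪ F' : Set (Set G)) < κ :=
    (Cardinal.mk_union_le _ _).trans_lt (Cardinal.add_lt_of_lt hκ.le
      (Cardinal.mk_range_le.trans_lt hJ)
      ((Cardinal.mk_le_mk_of_subset fun Z hZ => hZ.1).trans_lt hFκ))
  have hsub : ∀ j, ⋂₀ (Set.range S ∪ F') ⊆ S j := fun j =>
    Set.sInter_subset_of_mem (.inl ⟨j, rfl⟩)
  refine ⟨⋂₀ (Set.range S ∪ F'), ⟨_, hcard, hdef, rfl⟩, (hsub (∅, 0)).trans (hSA _), ?_, ?_,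
    ?_, ?_⟩
  · exact (Set.subset_iInter fun j => (hsub j).trans (hS2 j)).trans (hpowT 2)
  · exact fun h => Set.sInter_subset_sInter fun Z hZ => .inr ⟨hZ, h⟩
  · refine isThick_sInter hκ hM hcard hdef ?_
    rintro Z (⟨j, rfl⟩ | hZ)
    · exact hSt j
    · exact hZ.2 Z (hF Z hZ.1) (Set.sInter_subset_of_mem hZ.1)
  · exact (Set.subset_iInter fun j => (Set.pow_subset_pow_left (hsub j)).trans (hS4 j)).trans
      (hpowT 4)

end Assembly

end DefinableGroup

end MSLanguage

theorem mainTheorem2 {L : MSLanguage.{u, v}} (M : L.Sorts → Type w) [L.Structure M]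
    (κ : Cardinal.{w}) (hκ : ℵ₀ < κ) (hM : MSLanguage.IsSaturated L M κ)
    (G : MSLanguage.DefinableGroup L M)
    (A : Set G) (hA : G.IsDefinable A) (hA_symm : G.IsSymmetric A)
    (T : ℕ → Set G) (hT : G.IsErrorSequence A T)
    (μ : ℕ → Set G → ℝ≥0∞) (hμ : G.IsRoughAmenable A T μ)
    (m r : ℕ) (K : ℕ → ℕ) (hK : ∀ i, μ i (A ^ (2 * m + r)) ≤ (K i : ℝ≥0∞))
    (B : Set G) (hB : G.IsTypeDefinable κ B) (hBA : B ⊆ A ^ m) (hB_thick : G.IsThick B A) :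
    ∃ S : Set G, G.IsTypeDefinable κ S ∧ S ⊆ A ^ (2 * m) ∧ S ⊆ B ^ 2 * ⋂ i, T i ∧
      (G.IsThick B (A ^ m) → S ⊆ B ^ 2) ∧
      G.IsThick S (A ^ m) ∧ S ^ r ⊆ B ^ 4 * ⋂ i, T i := by
  have h1B : (1 : G) ∈ B := by
    obtain ⟨F, -, hF, rfl⟩ := hB
    exact hB_thick.one_mem_sInter hF ⟨1, hA_symm.1⟩
  have h1T : (1 : G) ∈ ⋂ i, T i := Set.mem_iInter.2 fun i => hT.one_mem i
  have hB2 : B ⊆ B ^ 2 := by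
    rw [sq]
    exact Set.subset_mul_left B h1B
  -- Here `S = B` works. This disposes of `m = 0` and of `m = 1`, `r = 0`, where `A ^ (2 * m + r)`
  -- is too small for the general argument.
  by_cases hcase : G.IsThick B (A ^ m) ∧ B ^ r ⊆ B ^ 4 * ⋂ i, T i
  · exact ⟨B, hB, hBA.trans (hA_symm.pow_subset_pow (by omega)),
      hB2.trans (Set.subset_mul_left _ h1T), fun _ => hB2, hcase.1, hcase.2⟩
  · have h14 : (1 : Set G) ⊆ B ^ 4 * ⋂ i, T i :=
      Set.one_subset.2 ⟨1, Set.one_mem_pow h1B, 1, h1T, mul_one 1⟩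
    have hm : m ≠ 0 := by
      rintro rfl
      rw [pow_zero] at hBA
      refine hcase ⟨fun Z _ hZ => ⟨1, fun g hg => ⟨0, 1, by simp, hZ ?_⟩⟩, ?_⟩
      · have h : ∀ i, g i = 1 := fun i => by simpa using hg i
        simpa [h] using h1B
      · refine ((Set.pow_subset_pow_left hBA).trans ?_).trans h14
        rw [one_pow]
    have hr : m = 1 → r ≠ 0 := by
      rintro rfl rfl
      exact hcase ⟨by rwa [pow_one], by rwa [pow_zero]⟩
    obtain ⟨S, hS, hSA, hS2, hSB, hSt, hS4⟩ :=
      MSLanguage.DefinableGroup.exists_isTypeDefinable_isThick hκ hM hA hA_symm hT hμ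
        -- The least `s ≥ 1` with `r ≤ 2 * s`; the bound `2 * s + 1 ≤ 2 * m + r` uses the exclusions
        -- just made.
        (m := m) (r := r) (s := max ((r + 1) / 2) 1) (n := 2 * m + r) (by omega) (by omega)
        (by omega) (by omega) (fun j => ne_top_of_le_ne_top (ENNReal.natCast_ne_top _) (hK j))
        hB hB_thick
    exact ⟨S, hS, hSA, hS2, fun h => (hSB h).trans hB2, hSt, hS4⟩
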